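/- Let $p,q\ge 0$ be integers, not both zero, let $d=\gcd(p,q)$, $p=dp'$, $q=dq'$, and write $u=x^{p'}y^{q'}$. Let $k\ge 1$, let $h\in\mathbb C\{u\}$ with $h(0)\ne 0$, and let $\mathcal F_\Omega$ be the germ of holomorphic foliation of $(\mathbb C^3,0)$ defined by $$\Omega=d(z^2+u^d)+u^k h(u)\,dz .$$ If $2k=d$, assume that $h(0)^2\neq \frac{(16+s)^2}{16+2s}$ for every rational $s\ge 0$. If $2k<d$, assume that the separatrix through the saddle-node that appears in the reduction of singularities is convergent, i.e. that there is a holomorphic germ $\sigma(x,y)$ at $0\in\mathbb C^2$ with $\sigma(0,0)=-h(0)/2$ such that the surface $z=u^k\sigma(x,y)$ is invariant for $\mathcal F_\Omega$. Put $r=d$ if $2k\ge d$ and $r=2k$ if $2k<d$. Then there is $g\in\mathbb C\{u,z\}$ such that $\mathcal F_\Omega$ is analytically equivalent to the foliation defined by $$d\big(z^2+(x^{p'}y^{q'})^r\big)+g(x^{p'}y^{q'},z)\,x^{p'}y^{q'}z\left(2\frac{dz}{z}-r\Big(p'\frac{dx}{x}+q'\frac{dy}{y}\Big)\right),$$ that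 is, there are a germ of biholomorphism $\Phi$ of $(\mathbb C^3,0)$ and a unit $v$ such that $\Phi^*\Omega$ is $v$ times this form. Moreover the separatrix of $\mathcal F_\Omega$ (the union of all germs at $0$ of invariant hypersurfaces, which is itself an invariant hypersurface) is analytically equivalent to the germ of $z^2+(x^{p'}y^{q'})^r=0$. -/

import Mathlib

open Filter Topology

namespace CuspidalFoliation

/-- The ambient space `ℂ³`, with coordinates `x = P 0`, `y = P 1`, `z = P 2`. -/
abbrev C3 : Type := Fin 3 → ℂ

/-- (Representatives of germs at the origin of) differential `1`-forms on `ℂ³`. -/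
abbrev OneForm : Type := C3 → (C3 →L[ℂ] ℂ)

/-- The form `dz`. -/
noncomputable def dz : C3 →L[ℂ] ℂ := ContinuousLinearMap.proj 2

/-- The monomial `u = x ^ a * y ^ b`. -/
def mon (a b : ℕ) (P : C3) : ℂ := P 0 ^ a * P 1 ^ b

/-- The function `z ^ 2 + (x ^ a * y ^ b) ^ r`. -/
def surf (a b r : ℕ) (P : C3) : ℂ := P 2 ^ 2 + mon a b P ^ r

/-- The form `Ω = d (z² + u ^ d) + u ^ k h(u) dz`, where `u = x ^ a * y ^ b`. -/
noncomputable def cuspForm (a b d k : ℕ) (h : ℂ → ℂ) : OneForm := fun P =>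
  fderiv ℂ (surf a b d) P + (mon a b P ^ k * h (mon a b P)) • dz

/-- The form `d (z² + u ^ r) + g(u, z) (2 u dz - r z du)`, where `u = x ^ a * y ^ b`. As
`du = u (a dx / x + b dy / y)`, the last factor is `u z (2 dz / z - r a dx / x - r b dy / y)`. -/
noncomputable def normalForm (a b r : ℕ) (g : ℂ × ℂ → ℂ) : OneForm := fun P =>
  fderiv ℂ (surf a b r) P +
    g (mon a b P, P 2) • ((2 * mon a b P) • dz - ((r : ℂ) * P 2) • fderiv ℂ (mon a b) P)

/-- `Φ` is a germ of biholomorphism of `(ℂ³, 0)`. -/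
def IsBiholomorphicGerm (Φ : C3 → C3) : Prop :=
  AnalyticAt ℂ Φ 0 ∧ Φ 0 = 0 ∧ (fderiv ℂ Φ 0).IsInvertible

/-- The pull-back `Φ^* ω`. -/
noncomputable def pullback (Φ : C3 → C3) (ω : OneForm) : OneForm := fun P =>
  (ω (Φ P)).comp (fderiv ℂ Φ P)

/-- The foliations of `(ℂ³, 0)` defined by `ω₁` and `ω₂` are analytically equivalent: for some
germ of biholomorphism `Φ`, the forms `Φ^* ω₁` and `ω₂` differ by a unit. -/
def FoliationEquiv (ω₁ ω₂ : OneForm) : Prop :=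
  ∃ (Φ : C3 → C3) (v : C3 → ℂ), IsBiholomorphicGerm Φ ∧ AnalyticAt ℂ v 0 ∧ v 0 ≠ 0 ∧
    ∀ᶠ P in 𝓝 (0 : C3), pullback Φ ω₁ P = v P • ω₂ P

/-- `f = 0` is (the equation of) a germ of hypersurface of `(ℂ³, 0)` that is invariant for the
foliation defined by `ω`: `f` is a nonzero germ of holomorphic function that vanishes at the
origin, and it divides all the coefficients of `ω ∧ df`. -/
def IsInvariantEquation (ω : OneForm) (f : C3 → ℂ) : Prop :=
  AnalyticAt ℂ f 0 ∧ f 0 = 0 ∧ (¬ ∀ᶠ P in 𝓝 (0 : C3), f P = 0) ∧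
    ∀ v w : C3, ∃ c : C3 → ℂ, AnalyticAt ℂ c 0 ∧
      ∀ᶠ P in 𝓝 (0 : C3), ω P v * fderiv ℂ f P w - ω P w * fderiv ℂ f P v = f P * c P

/-- The germ of `V` at the origin is the separatrix of the foliation defined by `ω`, i.e. the
union of all its separatrices: it is an invariant hypersurface that contains every invariant
hypersurface. -/
def IsSeparatrix (ω : OneForm) (V : Set C3) : Prop :=
  (∃ f : C3 → ℂ, IsInvariantEquation ω f ∧ ∀ᶠ P in 𝓝 (0 : C3), P ∈ V ↔ f P = 0) ∧
    ∀ f : C3 → ℂ, IsInvariantEquation ω f → ∀ᶠ P in 𝓝 (0 : C3), f P = 0 → P ∈ V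

/-- The germs at the origin of `V` and `W` are analytically equivalent. -/
def SetGermEquiv (V W : Set C3) : Prop :=
  ∃ Φ : C3 → C3, IsBiholomorphicGerm Φ ∧ ∀ᶠ P in 𝓝 (0 : C3), Φ P ∈ V ↔ P ∈ W

/-- For `2 k < d`: after the blow-ups `z = t u ^ k`, the transform of the foliation of `Ω` has at
`(x, y, t) = (0, 0, - h(0) / 2)` a singularity of saddle-node type, with a smooth, possibly only
formal, separatrix `t = σ(x, y)`. This says that this separatrix converges. -/
def HasConvergentSaddleNodeSeparatrix (a b d k : ℕ) (h : ℂ → ℂ) : Prop :=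
  ∃ σ : ℂ × ℂ → ℂ, AnalyticAt ℂ σ 0 ∧ σ 0 = - h 0 / 2 ∧
    IsInvariantEquation (cuspForm a b d k h) (fun P => P 2 - mon a b P ^ k * σ (P 0, P 1))

end CuspidalFoliation

/-!
Everything happens over the plane of `(u, z)`: the form is the pull-back of
`(2 z + u ^ k h(u)) dz + d u ^ (d - 1) du` by `(x, y, z) ↦ (u, z)`, so the graph `z = ζ(u)` is
invariant as soon as `(2 ζ + u ^ k h) ζ' + d u ^ (d - 1) = 0` (`IsSolution`).

*Two invariant graphs.* With `ζ = u ^ e * t(u)` and `e = min (k, d / 2)`, the equation becomes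
`(2 t + G) (u t' + e t) + E = 0` with `G = u ^ (k - e) h`, `E = d u ^ (d - 2 e)`. It is of
Briot–Bouquet type: a root `t₀` of the equation at `u = 0` with `2 t₀ + G(0) ≠ 0` extends to a
unique formal solution if `2 e t₀ + (2 t₀ + G(0)) (e + n)` never vanishes, and a majorant series
shows that it converges (`exists_analytic_solution`).
* If `2 k = d`, the roots satisfy `t₁ t₂ = 1` and `t₁ + t₂ = - h(0) / 2`, and the hypothesis on
  `h(0)` says exactly that `t₁ / t₂` is not a positive rational number (`not_resonant`).
* If `2 k < d`, one root is `0`; at the other one, `- h(0) / 2`, the equation degenerates to a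
  saddle-node. There the convergent separatrix `σ(x, y)` is restricted to the diagonal `x = y = s`.
  The equation still has at most one solution, so `σ(s, s)` is invariant under the roots of unity
  of order `a + b`, hence a function of `u = s ^ (a + b)`
  (`HasConvergentSaddleNodeSeparatrix.exists_solution`).
* If `2 k > d`, the roots are `± i`. For odd `d` the exponent `e` is a half-integer, and the
  solutions live on the double cover `u = w ^ 2`, where `w ↦ -w` exchanges them
  (`conclusion_of_odd`).

*Normal form.* Write the two graphs as `z = u β₁ ± i α u ^ (r / 2)`. Whatever the parity of `r`,
the germs `α` and `β₁` are analytic in `u`, `α(0) ≠ 0`, and the even and odd parts of the two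
equations are identities between `α`, `β₁` and `h` (`IsSplitting`). By these identities the map
`(x, y, z) ↦ (x, y, α z + u β₁)` pulls `Ω` back to a unit times the normal form, and it sends
`z ^ 2 + u ^ r = 0` to the union of the two graphs (`IsSplitting.foliationEquiv`,
`IsSplitting.setGermEquiv`).

*There are no other invariant hypersurfaces.* Let `f = 0` be invariant and suppose that `f`
vanishes identically on neither graph. Restrict `f` to the curves that lie on the two graphs above
a general line of the `(x, y)`-plane, and let `m₁, m₂ ≥ 1` be its orders there. The two curves
agree up to order `u ^ e`, hence so do the cofactors of `f` along them, while their coefficients at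
this order are `m₁ (2 t₁(0) + G(0))` and `m₂ (2 t₂(0) + G(0))` up to a common factor. But these
numbers differ in each of the cases (`vanishes_on_graph`). So `f` is divisible by the equation of
one of the graphs; the quotient is a unit or is again invariant, and an induction on the order of
`f` along a line shows that `f = 0` is contained in the union of the graphs (`zero_mem_graphs`).
For odd `d` this is applied to the pull-back of `f` by `(x, y, z) ↦ (x ^ 2, y ^ 2, z)`.
-/

namespace CuspidalFoliation

/-! ### Power series of one variable -/

theorem exists_coeff_bound {f : ℂ → ℂ} (hf : AnalyticAt ℂ f 0) :
    ∃ (a : ℕ → ℂ) (A R : ℝ), 0 < A ∧ 0 < R ∧ (∀ n, ‖a n‖ ≤ A * R ^ n) ∧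
      ∀ᶠ z in 𝓝 (0 : ℂ), HasSum (fun n => a n * z ^ n) (f z) := by
  obtain ⟨p, hp⟩ := hf
  obtain ⟨A, R, hA, hR, hb⟩ := p.le_mul_pow_of_radius_pos hp.radius_pos
  refine ⟨p.coeff, A, R, hA, hR, fun n => ?_, ?_⟩
  · rw [← FormalMultilinearSeries.norm_apply_eq_norm_coef]; exact hb n
  · filter_upwards [hasFPowerSeriesAt_iff.1 hp] with z hz
    simpa [mul_comm] using hz

theorem coeff_unique {f : ℂ → ℂ} {a b : ℕ → ℂ}
    (ha : ∀ᶠ z in 𝓝 (0 : ℂ), HasSum (fun n => a n * z ^ n) (f z))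
    (hb : ∀ᶠ z in 𝓝 (0 : ℂ), HasSum (fun n => b n * z ^ n) (f z)) : a = b := by
  have key : ∀ c : ℕ → ℂ, (∀ᶠ z in 𝓝 (0 : ℂ), HasSum (fun n => c n * z ^ n) (f z)) →
      HasFPowerSeriesAt f (FormalMultilinearSeries.ofScalars ℂ c) 0 := by
    intro c hc
    rw [hasFPowerSeriesAt_iff]
    filter_upwards [hc] with z hz
    simpa [FormalMultilinearSeries.coeff_ofScalars, mul_comm] using hz
  have := (key a ha).eq_formalMultilinearSeries (key b hb)
  funext n
  rw [← FormalMultilinearSeries.coeff_ofScalars (p := a),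
    ← FormalMultilinearSeries.coeff_ofScalars (p := b), this]

theorem analyticAt_of_coeff {f : ℂ → ℂ} {a : ℕ → ℂ}
    (ha : ∀ᶠ z in 𝓝 (0 : ℂ), HasSum (fun n => a n * z ^ n) (f z)) : AnalyticAt ℂ f 0 := by
  refine ⟨FormalMultilinearSeries.ofScalars ℂ a, ?_⟩
  rw [hasFPowerSeriesAt_iff]
  filter_upwards [ha] with z hz
  simpa [FormalMultilinearSeries.coeff_ofScalars, mul_comm] using hz

theorem exists_function_of_coeff_bound {a : ℕ → ℂ} {A R : ℝ} (hR : 0 < R)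
    (ha : ∀ n, ‖a n‖ ≤ A * R ^ n) :
    ∃ f : ℂ → ℂ, AnalyticAt ℂ f 0 ∧
      (∀ᶠ z in 𝓝 (0 : ℂ), HasSum (fun n => a n * z ^ n) (f z)) ∧
      ∀ᶠ z in 𝓝 (0 : ℂ), HasSum (fun n : ℕ => (n : ℂ) * a n * z ^ n) (z * deriv f z) := by
  have hU : ∀ᶠ z in 𝓝 (0 : ℂ), z ∈ Metric.ball (0 : ℂ) (1 / (2 * R)) :=
    Metric.ball_mem_nhds _ (by positivity)
  have hu : Summable (fun n : ℕ => A * (1 / 2 : ℝ) ^ n) :=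
    (summable_geometric_of_lt_one (by norm_num) (by norm_num)).mul_left A
  have hle : ∀ n : ℕ, ∀ w ∈ Metric.ball (0 : ℂ) (1 / (2 * R)),
      ‖a n * w ^ n‖ ≤ A * (1 / 2 : ℝ) ^ n := by
    intro n w hw
    have hA : 0 ≤ A := by simpa using (norm_nonneg _).trans (ha 0)
    rw [mem_ball_zero_iff] at hw
    have h1 : R * ‖w‖ ≤ 1 / 2 := by
      have := mul_le_mul_of_nonneg_left hw.le hR.le
      calc R * ‖w‖ ≤ R * (1 / (2 * R)) := this
        _ = 1 / 2 := by field_simp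
    calc ‖a n * w ^ n‖ = ‖a n‖ * ‖w‖ ^ n := by rw [norm_mul, norm_pow]
      _ ≤ A * R ^ n * ‖w‖ ^ n := by gcongr; exact ha n
      _ = A * (R * ‖w‖) ^ n := by rw [mul_pow, mul_assoc]
      _ ≤ A * (1 / 2 : ℝ) ^ n := by gcongr
  have hs : ∀ᶠ z in 𝓝 (0 : ℂ), HasSum (fun n => a n * z ^ n) (∑' n : ℕ, a n * z ^ n) := by
    filter_upwards [hU] with z hz
    exact (Summable.of_norm_bounded hu fun n => hle n z hz).hasSum
  refine ⟨fun z => ∑' n : ℕ, a n * z ^ n, analyticAt_of_coeff hs, hs, ?_⟩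
  filter_upwards [hU] with z hz
  have := (Complex.hasSum_deriv_of_summable_norm hu (F := fun n w => a n * w ^ n)
    (fun n => by fun_prop) Metric.isOpen_ball hle hz).mul_left z
  refine this.congr_fun fun n => ?_
  symm
  rw [deriv_const_mul_field, deriv_pow_field]
  rcases n with _ | n
  · simp
  · simp only [Nat.add_sub_cancel, pow_succ]; ring

/-! ### Majorants -/

/-- As `x 0 = y 0 = 0`, the terms of index `N + 1` do not occur in the convolution. This lets the
bound for the first `N` terms control the next one. -/
theorem sum_antidiagonal_le_mul {x y : ℕ → ℝ} (hx : ∀ n, 0 ≤ x n) (hy : ∀ n, 0 ≤ y n)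
    (hx0 : x 0 = 0) (hy0 : y 0 = 0) (N : ℕ) :
    ∑ n ∈ Finset.range (N + 2), ∑ p ∈ Finset.HasAntidiagonal.antidiagonal n, x p.1 * y p.2 ≤
      (∑ n ∈ Finset.range (N + 1), x n) * ∑ n ∈ Finset.range (N + 1), y n := by
  rw [Finset.sum_mul_sum, ← Finset.sum_product']
  set s := (Finset.range (N + 1) ×ˢ Finset.range (N + 1)).filter fun p => p.1 + p.2 < N + 2 with hs
  have h1 : ∑ n ∈ Finset.range (N + 2), ∑ p ∈ Finset.HasAntidiagonal.antidiagonal n, x p.1 * y p.2 =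
      ∑ p ∈ s, x p.1 * y p.2 := by
    rw [← Finset.sum_fiberwise_of_maps_to (g := fun p : ℕ × ℕ => p.1 + p.2)
      (t := Finset.range (N + 2)) (by simp [hs])]
    refine Finset.sum_congr rfl fun n hn => ?_
    symm
    refine Finset.sum_subset (fun p hp => by simp at hp ⊢; exact hp.2) fun p hp hp' => ?_
    simp only [Finset.HasAntidiagonal.mem_antidiagonal, Finset.mem_range] at hp hn
    simp only [hs, Finset.mem_filter, Finset.mem_product, Finset.mem_range, hp, hn, and_true,
      not_and_or, not_lt] at hp'
    have : p.1 = 0 ∨ p.2 = 0 := by omega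
    rcases this with h | h <;> simp [h, hx0, hy0]
  rw [h1]
  exact Finset.sum_le_sum_of_subset_of_nonneg (Finset.filter_subset _ _)
    fun p _ _ => mul_nonneg (hx _) (hy _)

theorem sum_geometric_bound {b : ℕ → ℝ} {A R ρ : ℝ} (hA : 0 < A) (hR : 0 < R) (hρ : 0 < ρ)
    (hRρ : R * ρ ≤ 1 / 2) (hb : ∀ n, b n ≤ A * R ^ n) (N : ℕ) :
    ∑ n ∈ Finset.range N, (if n = 0 then 0 else b n * ρ ^ n) ≤ 2 * A * R * ρ := by
  have h2 : ∀ N : ℕ, ∑ n ∈ Finset.range (N + 1), (if n = 0 then 0 else b n * ρ ^ n) ≤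
      A * (R * ρ) * (2 - 2 * (1 / 2) ^ N) := by
    intro N
    induction N with
    | zero => simp
    | succ N ih =>
      rw [Finset.sum_range_succ]
      have h3 : b (N + 1) * ρ ^ (N + 1) ≤ A * (R * ρ) * (1 / 2) ^ N := by
        calc b (N + 1) * ρ ^ (N + 1) ≤ A * R ^ (N + 1) * ρ ^ (N + 1) := by
              gcongr; exact hb _
          _ = A * (R * ρ) * (R * ρ) ^ N := by ring
          _ ≤ _ := by gcongr
      simp only [Nat.succ_ne_zero, if_false]
      rw [pow_succ (1 / 2 : ℝ) N]
      linarith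
  rcases N with _ | N
  · simp; positivity
  refine (h2 N).trans ?_
  have : 0 ≤ A * (R * ρ) * (2 * (1 / 2) ^ N) := by positivity
  linarith

/-- The majorant argument: for small `ρ`, the partial sums of `∑ b n * ρ ^ n` and
`∑ ε n * ρ ^ n` without constant term stay below a small `B`. If those of `∑ a n * ρ ^ n` are at
most `η` up to some index, then up to the next one they are at most
`C * (B + B T + (2 η + B) η)`, which is again at most `η`. -/
theorem exists_geometric_bound {a b ε : ℕ → ℝ} {C T A R : ℝ} (hC : 0 < C) (hT : 0 ≤ T)
    (hA : 0 < A) (hR : 0 < R) (ha : ∀ n, 0 ≤ a n) (hb0 : ∀ n, 0 ≤ b n)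
    (hb : ∀ n, b n ≤ A * R ^ n) (hε : ∀ n, ε n ≤ A * R ^ n)
    (hrec : ∀ n, 1 ≤ n → a n ≤ C * (ε n + b n * T +
      ∑ p ∈ Finset.HasAntidiagonal.antidiagonal n, if p.1 = 0 ∨ p.2 = 0 then 0 else
        (2 * a p.1 + b p.1) * a p.2)) :
    ∃ A' R' : ℝ, 0 < R' ∧ ∀ n, a n ≤ A' * R' ^ n := by
  set η : ℝ := 1 / (8 * C) with hη
  have hηpos : 0 < η := by positivity
  set B : ℝ := min (1 / (4 * C)) (η / (4 * C * (1 + T))) with hB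
  have hBpos : 0 < B := by positivity
  set ρ : ℝ := min (1 / (2 * R)) (B / (2 * A * R)) with hρdef
  have hρ : 0 < ρ := by positivity
  have hRρ : R * ρ ≤ 1 / 2 := by
    calc R * ρ ≤ R * (1 / (2 * R)) := by gcongr; exact min_le_left _ _
      _ = 1 / 2 := by field_simp
  have hBρ : 2 * A * R * ρ ≤ B := by
    calc 2 * A * R * ρ ≤ 2 * A * R * (B / (2 * A * R)) := by gcongr; exact min_le_right _ _
      _ = B := by field_simp
  have hB1 : C * B ≤ 1 / 4 := by
    calc C * B ≤ C * (1 / (4 * C)) := by gcongr; exact min_le_left _ _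
      _ = 1 / 4 := by field_simp
  have hB2 : C * (B * (1 + T)) ≤ η / 4 := by
    calc C * (B * (1 + T)) ≤ C * ((η / (4 * C * (1 + T))) * (1 + T)) := by
          gcongr; exact min_le_right _ _
      _ = η / 4 := by field_simp
  set w : (ℕ → ℝ) → ℕ → ℝ := fun c n => if n = 0 then 0 else c n * ρ ^ n with hw
  have hw0 : ∀ c, w c 0 = 0 := fun c => by simp [hw]
  have hwn : ∀ c : ℕ → ℝ, (∀ n, 0 ≤ c n) → ∀ n, 0 ≤ w c n := by
    intro c hc n
    simp only [hw]
    split_ifs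
    · exact le_rfl
    · exact mul_nonneg (hc n) (by positivity)
  have hSb : ∀ N, ∑ n ∈ Finset.range N, w b n ≤ B := fun N =>
    (sum_geometric_bound hA hR hρ hRρ hb N).trans hBρ
  have hSε : ∀ N, ∑ n ∈ Finset.range N, w ε n ≤ B := fun N =>
    (sum_geometric_bound hA hR hρ hRρ hε N).trans hBρ
  have hstep : ∀ n, w a n ≤ C * (w ε n + w b n * T +
      ∑ p ∈ Finset.HasAntidiagonal.antidiagonal n, (2 * w a p.1 + w b p.1) * w a p.2) := by
    intro n
    rcases Nat.eq_zero_or_pos n with rfl | hn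
    · simp [hw0]
    have h1 := mul_le_mul_of_nonneg_right (hrec n hn) (pow_nonneg hρ.le n)
    have h2 : w a n = a n * ρ ^ n := by simp [hw, hn.ne']
    have h3 : w ε n = ε n * ρ ^ n := by simp [hw, hn.ne']
    have h4 : w b n = b n * ρ ^ n := by simp [hw, hn.ne']
    rw [h2, h3, h4]
    refine h1.trans_eq ?_
    rw [mul_assoc, add_mul, add_mul, Finset.sum_mul]
    congr 2
    · ring
    refine Finset.sum_congr rfl fun p hp => ?_
    rw [← Finset.HasAntidiagonal.mem_antidiagonal.1 hp]
    simp only [hw]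
    by_cases h1 : p.1 = 0
    · simp [h1]
    by_cases h2 : p.2 = 0
    · simp [h2]
    simp only [h1, h2, if_false, or_self, pow_add]
    ring
  have hmain : ∀ N, ∑ n ∈ Finset.range (N + 1), w a n ≤ η := by
    intro N
    induction N with
    | zero => simp [hw0, hηpos.le]
    | succ N ih =>
      set S := ∑ n ∈ Finset.range (N + 1), w a n with hS
      have hS0 : 0 ≤ S := Finset.sum_nonneg fun n _ => hwn a ha n
      have h1 : ∑ n ∈ Finset.range (N + 1), (2 * w a n + w b n) ≤ 2 * η + B := by
        rw [Finset.sum_add_distrib, ← Finset.mul_sum]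
        linarith [hSb (N + 1)]
      have h2 := sum_antidiagonal_le_mul (x := fun n => 2 * w a n + w b n) (y := w a)
        (fun n => by have := hwn a ha n; have := hwn b hb0 n; positivity) (hwn a ha)
        (by simp [hw0]) (hw0 a) N
      have h3 : (∑ n ∈ Finset.range (N + 1), (2 * w a n + w b n)) * S ≤ (2 * η + B) * η := by
        gcongr
      calc ∑ n ∈ Finset.range (N + 2), w a n
          ≤ ∑ n ∈ Finset.range (N + 2), C * (w ε n + w b n * T +
              ∑ p ∈ Finset.HasAntidiagonal.antidiagonal n, (2 * w a p.1 + w b p.1) * w a p.2) :=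
            Finset.sum_le_sum fun n _ => hstep n
        _ = C * (∑ n ∈ Finset.range (N + 2), w ε n + (∑ n ∈ Finset.range (N + 2), w b n) * T +
              ∑ n ∈ Finset.range (N + 2),
              ∑ p ∈ Finset.HasAntidiagonal.antidiagonal n, (2 * w a p.1 + w b p.1) * w a p.2) := by
            rw [← Finset.mul_sum, Finset.sum_add_distrib, Finset.sum_add_distrib, Finset.sum_mul]
        _ ≤ C * (B + B * T + (2 * η + B) * η) := by
            gcongr
            · exact hSε _
            · exact hSb _
            · exact h2.trans h3
        _ = C * (B * (1 + T)) + (2 * C * η) * η + C * B * η := by ring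
        _ ≤ η / 4 + (1 / 4) * η + 1 / 4 * η := by
            gcongr
            rw [hη]; apply le_of_eq; field_simp; norm_num
        _ ≤ η := by linarith
  refine ⟨max η (a 0), 1 / ρ, by positivity, fun n => ?_⟩
  rcases Nat.eq_zero_or_pos n with rfl | hn
  · simp
  have h1 : w a n ≤ η := (Finset.single_le_sum (f := w a) (fun i _ => hwn a ha i)
    (Finset.self_mem_range_succ n)).trans (hmain n)
  have h2 : w a n = a n * ρ ^ n := by simp [hw, hn.ne']
  rw [h2] at h1
  rw [one_div, inv_pow, ← div_eq_mul_inv, le_div_iff₀ (by positivity)]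
  exact h1.trans (le_max_left _ _)

/-! ### A Briot–Bouquet equation -/

/-- A sequence may be defined by a recursion that involves all the preceding terms. -/
theorem exists_seq_of_recursion (Φ : ℕ → (ℕ → ℂ) → ℂ) :
    ∃ t : ℕ → ℂ, ∀ n, t n = Φ n fun m => if m < n then t m else 0 := by
  let F : (n : ℕ) → ((m : ℕ) → m < n → ℂ) → ℂ := fun n prev =>
    Φ n fun m => if hm : m < n then prev m hm else 0
  refine ⟨fun n => WellFounded.fix (r := (· < ·)) Nat.lt_wfRel.wf F n, fun n => ?_⟩
  beta_reduce
  rw [WellFounded.fix_eq]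
  simp only [F]
  congr 1

/-- The divisors of the recursion grow linearly, which makes up for the factor `n` that the
derivative brings in. -/
theorem exists_linear_bound {c l : ℂ} (hl : l ≠ 0) (e : ℕ)
    (hres : ∀ n : ℕ, 1 ≤ n → c + l * (e + n) ≠ 0) :
    ∃ C : ℝ, 0 < C ∧ ∀ n : ℕ, 1 ≤ n → (n + 1 : ℝ) ≤ C * ‖c + l * (e + n)‖ := by
  have h1 : Tendsto (fun n : ℕ => (c + l * e - l) * (1 / ((n : ℂ) + 1)) + l) atTop
      (𝓝 ((c + l * e - l) * 0 + l)) :=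
    (tendsto_one_div_add_atTop_nhds_zero_nat.const_mul _).add_const _
  have h2 := h1.inv₀ (by simpa using hl)
  obtain ⟨C, hC⟩ := (Metric.isBounded_range_of_tendsto _ h2).exists_norm_le
  refine ⟨max C 1, by positivity, fun n hn => ?_⟩
  have h3 : ‖((c + l * e - l) * (1 / ((n : ℂ) + 1)) + l)⁻¹‖ ≤ C := hC _ ⟨n, rfl⟩
  have hn1 : ((n : ℂ) + 1) ≠ 0 := by exact_mod_cast n.succ_ne_zero
  have h4 : (c + l * e - l) * (1 / ((n : ℂ) + 1)) + l = (c + l * (e + n)) / (n + 1) := by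
    field_simp; ring
  rw [h4, norm_inv, norm_div] at h3
  have h5 : ‖(n : ℂ) + 1‖ = n + 1 := by
    have := Complex.norm_natCast (n + 1); push_cast at this; exact this
  rw [h5, inv_div, div_le_iff₀ (norm_pos_iff.2 (hres n hn))] at h3
  exact h3.trans (by gcongr; exact le_max_left _ _)

/-- The formal solution of `(2 t + G) (w t' + e t) + E = 0`. In the last conjunct, the coefficient
of `w ^ n` of the equation is solved for `t n`. -/
theorem exists_formal_solution {g ε : ℕ → ℂ} {t₀ : ℂ} {e : ℕ}
    (h0 : (2 * t₀ + g 0) * (e * t₀) + ε 0 = 0)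
    (hres : ∀ n : ℕ, 1 ≤ n → 2 * e * t₀ + (2 * t₀ + g 0) * (e + n) ≠ 0) :
    ∃ t : ℕ → ℂ, t 0 = t₀ ∧
      (∀ n, ∑ p ∈ Finset.HasAntidiagonal.antidiagonal n,
        (2 * t p.1 + g p.1) * ((e + p.2) * t p.2) + ε n = 0) ∧
      ∀ n, 1 ≤ n → (2 * e * t₀ + (2 * t₀ + g 0) * (e + n)) * t n =
        -(ε n + g n * (e * t₀) + ∑ p ∈ Finset.HasAntidiagonal.antidiagonal n,
          if p.1 = 0 ∨ p.2 = 0 then 0 else (2 * t p.1 + g p.1) * ((e + p.2) * t p.2)) := by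
  obtain ⟨t, ht⟩ := exists_seq_of_recursion fun n τ => if n = 0 then t₀ else
    -(ε n + g n * (e * t₀) + ∑ p ∈ Finset.HasAntidiagonal.antidiagonal n,
          if p.1 = 0 ∨ p.2 = 0 then 0 else (2 * τ p.1 + g p.1) * ((e + p.2) * τ p.2)) /
      (2 * e * t₀ + (2 * t₀ + g 0) * (e + n))
  have ht0 : t 0 = t₀ := by rw [ht]; simp
  have hmain : ∀ n, 1 ≤ n → (2 * e * t₀ + (2 * t₀ + g 0) * (e + n)) * t n =
        -(ε n + g n * (e * t₀) + ∑ p ∈ Finset.HasAntidiagonal.antidiagonal n,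
          if p.1 = 0 ∨ p.2 = 0 then 0 else (2 * t p.1 + g p.1) * ((e + p.2) * t p.2)) := by
    intro n hn
    rw [ht n, if_neg (by omega), mul_div_cancel₀ _ (hres n hn)]
    congr 2
    refine Finset.sum_congr rfl fun p hp => ?_
    rw [Finset.HasAntidiagonal.mem_antidiagonal] at hp
    by_cases h1 : p.1 = 0 ∨ p.2 = 0
    · rw [if_pos h1, if_pos h1]
    · rw [if_neg h1, if_neg h1]
      beta_reduce
      rw [if_pos (by omega), if_pos (by omega)]
  refine ⟨t, ht0, fun n => ?_, hmain⟩
  rcases Nat.eq_zero_or_pos n with rfl | hn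
  · simpa [ht0] using h0
  have h1 : ∑ p ∈ Finset.HasAntidiagonal.antidiagonal n,
        (2 * t p.1 + g p.1) * ((e + p.2) * t p.2) =
      ∑ p ∈ Finset.HasAntidiagonal.antidiagonal n,
        ((if p.1 = 0 ∨ p.2 = 0 then 0 else (2 * t p.1 + g p.1) * ((e + p.2) * t p.2)) +
          (if p = (n, 0) then (2 * t n + g n) * (e * t₀) else 0) +
          (if p = (0, n) then (2 * t₀ + g 0) * ((e + n) * t n) else 0)) := by
    refine Finset.sum_congr rfl fun p hp => ?_
    rw [Finset.HasAntidiagonal.mem_antidiagonal] at hp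
    obtain ⟨i, j⟩ := p
    simp only at hp
    rcases Nat.eq_zero_or_pos i with rfl | hi
    · obtain rfl : j = n := by omega
      simp [ht0, hn.ne]
    · rcases Nat.eq_zero_or_pos j with rfl | hj
      · obtain rfl : i = n := by omega
        simp [ht0, hn.ne']
      · simp [hi.ne', hj.ne']
  rw [h1, Finset.sum_add_distrib, Finset.sum_add_distrib, Finset.sum_ite_eq', Finset.sum_ite_eq',
    if_pos (by simp), if_pos (by simp)]
  linear_combination hmain n hn

/-- The initial value problem `(2 t + G) (w t' + e t) + E = 0`, `t 0 = t₀`, with a regular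
singular point at `w = 0`, has a convergent solution if it is not resonant. -/
theorem exists_analytic_solution {G E : ℂ → ℂ} (hG : AnalyticAt ℂ G 0) (hE : AnalyticAt ℂ E 0)
    {t₀ : ℂ} {e : ℕ} (h0 : (2 * t₀ + G 0) * (e * t₀) + E 0 = 0) (hne : 2 * t₀ + G 0 ≠ 0)
    (hres : ∀ n : ℕ, 1 ≤ n → 2 * e * t₀ + (2 * t₀ + G 0) * (e + n) ≠ 0) :
    ∃ t : ℂ → ℂ, AnalyticAt ℂ t 0 ∧ t 0 = t₀ ∧
      ∀ᶠ w in 𝓝 (0 : ℂ), (2 * t w + G w) * (w * deriv t w + e * t w) + E w = 0 := by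
  obtain ⟨g, A₁, R₁, hA₁, hR₁, hg, hgs⟩ := exists_coeff_bound hG
  obtain ⟨ε, A₂, R₂, hA₂, hR₂, hε, hεs⟩ := exists_coeff_bound hE
  have hz : ∀ {f : ℂ → ℂ} {a : ℕ → ℂ}, (∀ᶠ z in 𝓝 (0 : ℂ), HasSum (fun n => a n * z ^ n) (f z)) →
      f 0 = a 0 := by
    intro f a ha
    refine ha.self_of_nhds.unique ?_
    simpa using hasSum_single (f := fun n => a n * (0 : ℂ) ^ n) 0 (by
      intro n hn; simp [hn])
  rw [hz hgs] at h0 hne hres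
  rw [hz hεs] at h0
  obtain ⟨t, ht0, hrec, hlin⟩ := exists_formal_solution h0 hres
  obtain ⟨C, hC, hbound⟩ := exists_linear_bound (c := 2 * e * t₀) hne e hres
  obtain ⟨A', R', hR', ht⟩ : ∃ A' R' : ℝ, 0 < R' ∧ ∀ n, ‖t n‖ ≤ A' * R' ^ n := by
    refine exists_geometric_bound (b := fun n => ‖g n‖) (ε := fun n => ‖ε n‖)
      (C := C * (e + 1)) (T := ‖t₀‖) (A := max A₁ A₂) (R := max R₁ R₂)
      (by positivity) (norm_nonneg _) (by positivity) (by positivity) (fun _ => norm_nonneg _)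
      (fun _ => norm_nonneg _)
      (fun n => (hg n).trans (by gcongr <;> exact le_max_left _ _))
      (fun n => (hε n).trans (by gcongr <;> exact le_max_right _ _)) fun n hn => ?_
    have h1 : ‖(2 * e * t₀ + (2 * t₀ + g 0) * (e + n))‖ * ‖t n‖ ≤ (n + 1) * ((e + 1) *
        (‖ε n‖ + ‖g n‖ * ‖t₀‖ + ∑ p ∈ Finset.HasAntidiagonal.antidiagonal n,
          if p.1 = 0 ∨ p.2 = 0 then 0 else (2 * ‖t p.1‖ + ‖g p.1‖) * ‖t p.2‖)) := by
      rw [← norm_mul, hlin n hn, norm_neg]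
      have he : (1 : ℝ) ≤ (n + 1) * (e + 1) := by
        have h1 : (0 : ℝ) ≤ n := n.cast_nonneg
        have h2 : (0 : ℝ) ≤ e := e.cast_nonneg
        nlinarith
      have he' : (e : ℝ) ≤ (n + 1) * (e + 1) := by
        have h1 : (0 : ℝ) ≤ n := n.cast_nonneg
        have h2 : (0 : ℝ) ≤ e := e.cast_nonneg
        nlinarith
      refine (norm_add₃_le).trans ?_
      rw [← mul_assoc (n + 1 : ℝ), mul_add, mul_add, Finset.mul_sum]
      refine add_le_add (add_le_add ?_ ?_) ?_
      · exact le_mul_of_one_le_left (norm_nonneg _) he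
      · rw [norm_mul, norm_mul, Complex.norm_natCast]
        calc ‖g n‖ * (e * ‖t₀‖) = e * (‖g n‖ * ‖t₀‖) := by ring
          _ ≤ _ := by gcongr
      · refine norm_sum_le_of_le _ fun p hp => ?_
        rw [Finset.HasAntidiagonal.mem_antidiagonal] at hp
        split_ifs
        · simp
        · have hp2 : ‖(e : ℂ) + p.2‖ ≤ (n + 1) * (e + 1) := by
            refine (norm_add_le _ _).trans ?_
            rw [Complex.norm_natCast, Complex.norm_natCast]
            have h1 : (p.2 : ℝ) ≤ n := by exact_mod_cast (by omega : p.2 ≤ n)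
            have h2 : (0 : ℝ) ≤ e := e.cast_nonneg
            have h3 : (0 : ℝ) ≤ p.2 := p.2.cast_nonneg
            nlinarith
          rw [norm_mul, norm_mul]
          have h4 : ‖2 * t p.1 + g p.1‖ ≤ 2 * ‖t p.1‖ + ‖g p.1‖ := by
            refine (norm_add_le _ _).trans ?_
            simp
          calc ‖2 * t p.1 + g p.1‖ * (‖(e : ℂ) + p.2‖ * ‖t p.2‖)
              ≤ (2 * ‖t p.1‖ + ‖g p.1‖) * ((n + 1) * (e + 1) * ‖t p.2‖) := by gcongr
            _ = _ := by ring
    have h2 : (n + 1 : ℝ) * ‖t n‖ ≤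
        C * ‖(2 * e * t₀ + (2 * t₀ + g 0) * (e + n))‖ * ‖t n‖ := by
      gcongr; exact hbound n hn
    have hn1 : (0 : ℝ) < n + 1 := by positivity
    refine le_of_mul_le_mul_left (h2.trans ?_) hn1
    rw [mul_assoc]
    refine (mul_le_mul_of_nonneg_left h1 hC.le).trans_eq ?_
    ring
  obtain ⟨f, hf, hfs, hfs'⟩ := exists_function_of_coeff_bound hR' ht
  refine ⟨f, hf, by rw [hz hfs, ht0], ?_⟩
  filter_upwards [hfs, hfs', hgs, hεs] with w h1 h2 h3 h4
  have hx : HasSum (fun n => (2 * t n + g n) * w ^ n) (2 * f w + G w) := by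
    exact ((h1.mul_left 2).add h3).congr_fun fun n => by ring
  have hy : HasSum (fun n : ℕ => ((e + n) * t n) * w ^ n) (w * deriv f w + e * f w) := by
    exact (h2.add (h1.mul_left (e : ℂ))).congr_fun fun n => by ring
  have hxy := tsum_mul_tsum_eq_tsum_sum_antidiagonal_of_summable_norm hx.summable.norm
    hy.summable.norm
  rw [hx.tsum_eq, hy.tsum_eq] at hxy
  rw [hxy, ← h4.tsum_eq, add_eq_zero_iff_eq_neg, ← tsum_neg]
  refine tsum_congr fun n => ?_
  have : ∀ p ∈ Finset.HasAntidiagonal.antidiagonal n,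
      (2 * t p.1 + g p.1) * w ^ p.1 * ((e + p.2) * t p.2 * w ^ p.2) =
        (2 * t p.1 + g p.1) * ((e + p.2) * t p.2) * w ^ n := by
    intro p hp
    rw [← Finset.HasAntidiagonal.mem_antidiagonal.1 hp, pow_add]; ring
  rw [Finset.sum_congr rfl this, ← Finset.sum_mul]
  linear_combination w ^ n * hrec n

/-- Uniqueness of the solution of the equation of `exists_analytic_solution`. The hypothesis
`hres` also holds at a saddle-node, where `2 * t₀ + G 0 = 0`. -/
theorem analytic_solution_unique {G E t₁ t₂ : ℂ → ℂ} {e : ℕ} (hG : AnalyticAt ℂ G 0)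
    (ht₁ : AnalyticAt ℂ t₁ 0) (ht₂ : AnalyticAt ℂ t₂ 0) (h0 : t₁ 0 = t₂ 0)
    (hres : ∀ n : ℕ, 1 ≤ n → 2 * e * t₁ 0 + (2 * t₁ 0 + G 0) * (e + n) ≠ 0)
    (h₁ : ∀ᶠ w in 𝓝 (0 : ℂ), (2 * t₁ w + G w) * (w * deriv t₁ w + e * t₁ w) + E w = 0)
    (h₂ : ∀ᶠ w in 𝓝 (0 : ℂ), (2 * t₂ w + G w) * (w * deriv t₂ w + e * t₂ w) + E w = 0) :
    ∀ᶠ w in 𝓝 (0 : ℂ), t₁ w = t₂ w := by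
  by_contra hcon
  have hδ : AnalyticAt ℂ (fun w => t₁ w - t₂ w) 0 := ht₁.sub ht₂
  obtain ⟨n, ψ, hψ, hψ0, hn⟩ := hδ.exists_eventuallyEq_pow_smul_nonzero_iff.2
    (fun h => hcon (h.mono fun w hw => sub_eq_zero.1 hw))
  have hn1 : 1 ≤ n := by
    by_contra hn0
    obtain rfl : n = 0 := by omega
    have := hn.self_of_nhds
    simp [h0] at this
    exact hψ0 this.symm
  simp only [sub_zero, smul_eq_mul] at hn
  have hpun : ∀ᶠ w in 𝓝[≠] (0 : ℂ), (2 * t₁ w + G w) * ((n + e) * ψ w + w * deriv ψ w) +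
      2 * ψ w * (w * deriv t₂ w + e * t₂ w) = 0 := by
    have hev : ∀ᶠ w in 𝓝 (0 : ℂ), w ≠ 0 → (2 * t₁ w + G w) * ((n + e) * ψ w + w * deriv ψ w) +
      2 * ψ w * (w * deriv t₂ w + e * t₂ w) = 0 := by
      filter_upwards [h₁, h₂, hn, hn.eventually_nhds, hψ.eventually_analyticAt,
        ht₁.eventually_analyticAt, ht₂.eventually_analyticAt] with w e1 e2 e3 e4 a1 a2 a3 hw
      have hd : deriv t₁ w - deriv t₂ w = n * w ^ (n - 1) * ψ w + w ^ n * deriv ψ w := by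
        rw [← deriv_fun_sub a2.differentiableAt a3.differentiableAt, EventuallyEq.deriv_eq e4]
        simpa using (((hasDerivAt_pow n w).fun_mul a1.differentiableAt.hasDerivAt).deriv)
      have hp : w * w ^ (n - 1) = w ^ n := by
        rw [← pow_succ']; congr 1; omega
      refine (mul_eq_zero.1 (?_ : w ^ n * _ = 0)).resolve_left (pow_ne_zero n hw)
      linear_combination e1 - e2 - (2 * t₁ w + G w) * w * hd -
        (2 * t₁ w + G w) * n * ψ w * hp -
        ((2 * t₁ w + G w) * e + 2 * (w * deriv t₂ w + e * t₂ w)) * e3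
    exact eventually_nhdsWithin_of_eventually_nhds hev |>.and self_mem_nhdsWithin
      |>.mono fun w h => h.1 h.2
  have hcont : ContinuousAt (fun w => (2 * t₁ w + G w) * ((n + e) * ψ w + w * deriv ψ w) +
      2 * ψ w * (w * deriv t₂ w + e * t₂ w)) 0 := by
    have := ht₁.continuousAt; have := ht₂.continuousAt; have := hG.continuousAt
    have := hψ.continuousAt; have := hψ.deriv.continuousAt; have := ht₂.deriv.continuousAt
    fun_prop
  have h3 := tendsto_nhds_unique (hcont.tendsto.mono_left nhdsWithin_le_nhds)
    (tendsto_const_nhds.congr' (hpun.mono fun w hw => hw.symm))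
  simp only [zero_mul, zero_add, add_zero, ← h0] at h3
  refine hres n hn1 ((mul_eq_zero.1 (?_ : ψ 0 * _ = 0)).resolve_left hψ0)
  linear_combination h3

/-! ### Functions of a power of the variable -/

/-- An analytic germ that is invariant under the `M`-th roots of unity is a germ in `s ^ M`. -/
theorem exists_comp_pow {S : ℂ → ℂ} (hS : AnalyticAt ℂ S 0) {M : ℕ} (hM : 1 ≤ M)
    (hinv : ∀ ζ : ℂ, ζ ^ M = 1 → ∀ᶠ s in 𝓝 (0 : ℂ), S (ζ * s) = S s) :
    ∃ τ : ℂ → ℂ, AnalyticAt ℂ τ 0 ∧ ∀ᶠ s in 𝓝 (0 : ℂ), S s = τ (s ^ M) := by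
  obtain ⟨a, A, R, hA, hR, ha, has⟩ := exists_coeff_bound hS
  have hζ := Complex.isPrimitiveRoot_exp M (by omega)
  set ζ := Complex.exp (2 * Real.pi * Complex.I / M)
  have ha0 : ∀ n, ¬ M ∣ n → a n = 0 := by
    have h1 : (fun n => a n * ζ ^ n) = a := by
      refine coeff_unique (f := S) ?_ has
      have hz : Tendsto (fun s : ℂ => ζ * s) (𝓝 0) (𝓝 0) := by
        have : ContinuousAt (fun s : ℂ => ζ * s) 0 := by fun_prop
        simpa [ContinuousAt] using this
      filter_upwards [hz.eventually has, hinv ζ hζ.pow_eq_one] with s h1 h2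
      rw [h2] at h1
      exact h1.congr_fun fun n => by rw [mul_pow, mul_assoc]
    intro n hn
    have h2 := congrFun h1 n
    have h3 : ζ ^ n ≠ 1 := fun h => hn (hζ.dvd_of_pow_eq_one n h)
    have h4 : a n * (ζ ^ n - 1) = 0 := by linear_combination h2
    exact (mul_eq_zero.1 h4).resolve_right (sub_ne_zero.2 h3)
  obtain ⟨τ, hτ, hτs, -⟩ := exists_function_of_coeff_bound (a := fun m => a (M * m)) (A := A)
    (R := R ^ M) (by positivity) fun m => by rw [← pow_mul]; exact ha _
  refine ⟨τ, hτ, ?_⟩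
  have hz : Tendsto (fun s : ℂ => s ^ M) (𝓝 0) (𝓝 0) := by
    have : ContinuousAt (fun s : ℂ => s ^ M) 0 := by fun_prop
    simpa [ContinuousAt, show M ≠ 0 by omega] using this
  filter_upwards [has, hz.eventually hτs] with s h1 h2
  have hinj : Function.Injective fun m : ℕ => M * m := fun x y hxy =>
    Nat.eq_of_mul_eq_mul_left (by omega) hxy
  have h3 := (hinj.hasSum_iff (f := fun n => a n * s ^ n) (a := S s) (by
    intro n hn
    rw [ha0 n (fun ⟨m, hm⟩ => hn ⟨m, hm.symm⟩), zero_mul])).2 h1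
  refine h3.unique (h2.congr_fun fun m => ?_)
  simp [pow_mul]

theorem exists_even_odd {t : ℂ → ℂ} (ht : AnalyticAt ℂ t 0) :
    ∃ a b : ℂ → ℂ, AnalyticAt ℂ a 0 ∧ AnalyticAt ℂ b 0 ∧ ∀ᶠ w in 𝓝 (0 : ℂ),
      t w = a (w ^ 2) + w * b (w ^ 2) ∧ t (-w) = a (w ^ 2) - w * b (w ^ 2) := by
  have htn : AnalyticAt ℂ (fun w => t (-w)) 0 :=
    AnalyticAt.fun_comp (by simpa using ht) (analyticAt_id.neg)
  have hsgn : ∀ ζ : ℂ, ζ ^ 2 = 1 → ζ = 1 ∨ ζ = -1 := fun ζ h => sq_eq_one_iff.1 h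
  obtain ⟨a, ha, hat⟩ := exists_comp_pow (S := fun w => (t w + t (-w)) / 2) (M := 2)
    ((ht.add htn).div_const) (by norm_num) (by
      intro ζ hζ
      rcases hsgn ζ hζ with rfl | rfl
      · simp
      · exact Eventually.of_forall fun s => by simp [add_comm])
  have ho : AnalyticAt ℂ (fun w => (t w - t (-w)) / 2) 0 := (ht.sub htn).div_const
  obtain ⟨o, hoa, hoe⟩ := (natCast_le_analyticOrderAt ho (n := 1)).1 (by
    rw [Nat.cast_one, Order.one_le_iff_ne_zero, ho.analyticOrderAt_ne_zero]; simp)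
  have hneg : Tendsto (fun s : ℂ => -s) (𝓝 0) (𝓝 0) := by
    simpa using (continuous_neg (G := ℂ)).tendsto 0
  simp only [sub_zero, pow_one, smul_eq_mul] at hoe
  obtain ⟨b, hb, hbo⟩ := exists_comp_pow (S := o) (M := 2) hoa (by norm_num) (by
      intro ζ hζ
      rcases hsgn ζ hζ with rfl | rfl
      · simp
      · filter_upwards [hoe, hneg.eventually hoe] with w h1 h2
        by_cases hw : w = 0
        · simp [hw]
        · have : w * (o (-1 * w) - o w) = 0 := by
            rw [neg_neg] at h2
            rw [neg_one_mul]
            linear_combination h1 + h2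
          exact sub_eq_zero.1 ((mul_eq_zero.1 this).resolve_left hw))
  refine ⟨a, b, ha, hb, ?_⟩
  filter_upwards [hat, hoe, hbo] with w h1 h2 h3
  rw [h3] at h2
  constructor
  · linear_combination h1 + h2
  · linear_combination h1 - h2

/-! ### Germs of several variables -/

section SeveralVariables

variable {E : Type*} [NormedAddCommGroup E] [NormedSpace ℂ E]

theorem eventually_eq_zero_of_mul {f g : E → ℂ} (hf : AnalyticAt ℂ f 0) (hg : AnalyticAt ℂ g 0)
    (hfg : ∀ᶠ P in 𝓝 (0 : E), f P * g P = 0) (hf0 : ¬ ∀ᶠ P in 𝓝 (0 : E), f P = 0) :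
    ∀ᶠ P in 𝓝 (0 : E), g P = 0 := by
  obtain ⟨r, hr, hball⟩ := Metric.eventually_nhds_iff_ball.1
    ((hf.eventually_analyticAt.and hg.eventually_analyticAt).and hfg)
  have hgan : AnalyticOnNhd ℂ g (Metric.ball 0 r) := fun P hP => (hball P hP).1.2
  have hB : ∀ᶠ P in 𝓝 (0 : E), P ∈ Metric.ball (0 : E) r := Metric.ball_mem_nhds _ hr
  obtain ⟨P, hfP, hP⟩ := ((not_eventually.1 hf0).and_eventually hB).exists
  have h1 : g =ᶠ[𝓝 P] 0 := by
    filter_upwards [(hball P hP).1.1.continuousAt.eventually_ne hfP,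
      Metric.isOpen_ball.mem_nhds hP] with Q h1 h2
    exact (mul_eq_zero.1 (hball Q h2).2).resolve_left h1
  have h2 := hgan.eqOn_zero_of_preconnected_of_eventuallyEq_zero
    (convex_ball (0 : E) r).isPreconnected hP h1
  exact hB.mono fun Q hQ => h2 hQ

theorem eventually_eq_of_mul {f g₁ g₂ : E → ℂ} (hf : AnalyticAt ℂ f 0) (hg₁ : AnalyticAt ℂ g₁ 0)
    (hg₂ : AnalyticAt ℂ g₂ 0) (hfg : ∀ᶠ P in 𝓝 (0 : E), f P * g₁ P = f P * g₂ P)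
    (hf0 : ¬ ∀ᶠ P in 𝓝 (0 : E), f P = 0) : ∀ᶠ P in 𝓝 (0 : E), g₁ P = g₂ P :=
  (eventually_eq_zero_of_mul hf (hg₁.sub hg₂)
    (hfg.mono fun P hP => by simp [mul_sub, hP]) hf0).mono fun P hP => sub_eq_zero.1 hP

theorem exists_line_not_eventually_zero {f : E → ℂ} (hf : AnalyticAt ℂ f 0)
    (hf0 : ¬ ∀ᶠ P in 𝓝 (0 : E), f P = 0) :
    ∃ P : E, ¬ ∀ᶠ s in 𝓝 (0 : ℂ), f (s • P) = 0 := by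
  obtain ⟨r, hr, hball⟩ := Metric.eventually_nhds_iff_ball.1 hf.eventually_analyticAt
  have hB : ∀ᶠ P in 𝓝 (0 : E), P ∈ Metric.ball (0 : E) r := Metric.ball_mem_nhds _ hr
  obtain ⟨P, hfP, hP⟩ := ((not_eventually.1 hf0).and_eventually hB).exists
  refine ⟨P, fun hcon => hfP ?_⟩
  have hconv : Convex ℝ {s : ℂ | s • P ∈ Metric.ball (0 : E) r} :=
    (convex_ball (0 : E) r).linear_preimage
      (((LinearMap.toSpanSingleton ℂ E P).restrictScalars ℝ))
  have han : AnalyticOnNhd ℂ (fun s : ℂ => f (s • P)) {s : ℂ | s • P ∈ Metric.ball (0 : E) r} :=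
    fun s hs => AnalyticAt.fun_comp (hball _ hs) (by fun_prop)
  have := han.eqOn_zero_of_preconnected_of_eventuallyEq_zero hconv.isPreconnected
    (z₀ := 0) (by simpa using hr) hcon (x := 1) (by simpa using hP)
  simpa using this

/-- A difference of two values of a multilinear map, with the arguments replaced one by one. -/
theorem map_const_sub_map_const {n : ℕ} (p : E [×(n + 1)]→L[ℂ] ℂ) (π : E →L[ℂ] E) (P : E) :
    p (fun _ => P) - p (fun _ => π P) =
      ∑ j : Fin (n + 1), p (j.insertNth (P - π P)
        (fun i => if (i : ℕ) < j then π P else P)) := by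
  have h1 : ∀ j : Fin (n + 1), p (j.insertNth (P - π P)
        (fun i : Fin n => if (i : ℕ) < j then π P else P)) =
      p (fun i : Fin (n + 1) => if (i : ℕ) < (j : ℕ) then π P else P) -
        p (fun i : Fin (n + 1) => if (i : ℕ) < (j : ℕ) + 1 then π P else P) := by
    intro j
    have h2 : ∀ x, Function.update (fun i : Fin (n + 1) => if (i : ℕ) < (j : ℕ) then π P else P) j x
        = j.insertNth x (fun i : Fin n => if (i : ℕ) < j then π P else P) := by
      intro x
      rw [Fin.eq_insertNth_iff]
      refine ⟨by simp, ?_⟩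
      funext i
      simp only [Fin.removeNth]
      rw [Function.update_of_ne (Fin.succAbove_ne j i)]
      congr 1
      simp only [Fin.succAbove, Fin.lt_def, Fin.val_castSucc]
      split_ifs with h
      · simp
      · simp; omega
    rw [← h2, p.map_update_sub]
    congr 2
    · funext i
      by_cases hi : i = j
      · subst hi; simp
      · rw [Function.update_of_ne hi]
    · funext i
      by_cases hi : i = j
      · subst hi; simp
      · rw [Function.update_of_ne hi]
        have : (i : ℕ) ≠ j := fun h => hi (Fin.ext h)
        congr 1
        simp only [eq_iff_iff]; omega
  rw [Finset.sum_congr rfl fun j _ => h1 j, Fin.sum_univ_eq_sum_range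
    (fun j => p (fun i : Fin (n + 1) => if (i : ℕ) < j then π P else P) -
        p (fun i : Fin (n + 1) => if (i : ℕ) < j + 1 then π P else P)), Finset.sum_range_sub']
  congr 2
  funext i
  rw [if_pos i.2]

/-- Hadamard's lemma: if the projection `π` moves points in the direction `e` only, then
`f - f ∘ π` is divisible by the corresponding coordinate `ℓ`. -/
theorem exists_hadamard_quotient {f : E → ℂ} (hf : AnalyticAt ℂ f 0) (π : E →L[ℂ] E) (e : E)
    (ℓ : E →L[ℂ] ℂ) (hπ : ∀ P, P - π P = ℓ P • e) :
    ∃ g : E → ℂ, AnalyticAt ℂ g 0 ∧ ∀ᶠ P in 𝓝 (0 : E), f P - f (π P) = ℓ P * g P := by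
  obtain ⟨p, hp⟩ := hf
  obtain ⟨A, R, hA, hR, hb⟩ := p.le_mul_pow_of_radius_pos hp.radius_pos
  -- The terms of degree `n` of the quotient: in each summand of the telescoping sum for `p (n + 1)`
  -- one argument is `ℓ P • e`, from which the scalar is pulled out.
  set r : FormalMultilinearSeries ℂ E ℂ := fun n => ∑ j : Fin (n + 1),
    ((p (n + 1)).curryMid j e).compContinuousLinearMap
      (fun i : Fin n => if (i : ℕ) < j then π else ContinuousLinearMap.id ℂ E) with hr
  set c : ℝ := max 1 ‖π‖ with hc
  have hc1 : 1 ≤ c := le_max_left _ _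
  have hrn : ∀ n, ‖r n‖ ≤ (n + 1) * (A * R ^ (n + 1) * ‖e‖ * c ^ n) := by
    intro n
    refine (norm_sum_le _ _).trans ?_
    have : ∀ j ∈ (Finset.univ : Finset (Fin (n + 1))),
        ‖((p (n + 1)).curryMid j e).compContinuousLinearMap
      (fun i : Fin n => if (i : ℕ) < j then π else ContinuousLinearMap.id ℂ E)‖ ≤
        A * R ^ (n + 1) * ‖e‖ * c ^ n := by
      intro j _
      refine (ContinuousMultilinearMap.norm_compContinuousLinearMap_le _ _).trans ?_
      have h1 : ‖(p (n + 1)).curryMid j e‖ ≤ A * R ^ (n + 1) * ‖e‖ := by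
        refine (ContinuousLinearMap.le_opNorm _ _).trans ?_
        rw [ContinuousMultilinearMap.norm_curryMid]
        gcongr
        exact hb _
      have h2 : ∏ i : Fin n, ‖(if (i : ℕ) < j then π else ContinuousLinearMap.id ℂ E)‖ ≤ c ^ n := by
        refine (Finset.prod_le_prod (fun _ _ => norm_nonneg _) (g := fun _ => c) ?_).trans (by simp)
        intro i _
        split_ifs
        · exact le_max_right _ _
        · exact ContinuousLinearMap.norm_id_le.trans hc1
      gcongr
    refine (Finset.sum_le_card_nsmul _ _ _ this).trans ?_
    simp
  have hrad : 0 < r.radius := by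
    have hρ : 0 < 1 / (2 * (R * c)) := by positivity
    refine lt_of_lt_of_le ?_ (r.le_radius_of_bound (A * R * ‖e‖) (r := ⟨1 / (2 * (R * c)), hρ.le⟩)
      fun n => ?_)
    · exact ENNReal.coe_pos.2 hρ
    · have h2 : ((n : ℝ) + 1) * (1 / 2) ^ n ≤ 1 := by
        have : (n + 1 : ℝ) ≤ 2 ^ n := by exact_mod_cast Nat.succ_le_of_lt n.lt_two_pow_self
        rw [one_div, inv_pow, ← div_eq_mul_inv, div_le_one (by positivity)]
        exact this
      calc ‖r n‖ * (1 / (2 * (R * c))) ^ n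
          ≤ (n + 1) * (A * R ^ (n + 1) * ‖e‖ * c ^ n) * (1 / (2 * (R * c))) ^ n := by
            gcongr; exact hrn n
        _ = (A * R * ‖e‖) * (((n : ℝ) + 1) * (R * c * (1 / (2 * (R * c)))) ^ n) := by
            rw [mul_pow, mul_pow]; ring
        _ = (A * R * ‖e‖) * (((n : ℝ) + 1) * (1 / 2) ^ n) := by
            congr 3; field_simp
        _ ≤ (A * R * ‖e‖) * 1 := by gcongr
        _ = _ := mul_one _
  have hrs := r.hasFPowerSeriesOnBall hrad
  refine ⟨r.sum, hrs.analyticAt, ?_⟩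
  have hπ0 : Tendsto π (𝓝 0) (𝓝 0) := by simpa using π.continuous.tendsto 0
  have hball := hrs.hasFPowerSeriesAt.eventually_hasSum
  filter_upwards [hp.eventually_hasSum, hπ0.eventually hp.eventually_hasSum, hball] with P h1 h2 h3
  rw [zero_add] at h1 h2 h3
  have h4 := h1.sub h2
  have h5 : HasSum (fun n => ℓ P * r n fun _ => P) (f P - f (π P)) := by
    have h6 := (hasSum_nat_add_iff' 1).2 h4
    simp only [Finset.range_one, Finset.sum_singleton] at h6
    rw [Subsingleton.elim (fun _ : Fin 0 => π P) (fun _ : Fin 0 => P), sub_self, sub_zero] at h6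
    refine h6.congr_fun fun n => ?_
    rw [map_const_sub_map_const (p (n + 1)) π P, hr, _root_.sum_apply, Finset.mul_sum]
    refine Finset.sum_congr rfl fun j _ => ?_
    rw [hπ P, ContinuousMultilinearMap.compContinuousLinearMap_apply]
    have h7 := (p (n + 1)).curryMid_apply j (ℓ P • e)
      (fun i : Fin n => if (i : ℕ) < j then π P else P)
    rw [← h7, map_smul, _root_.smul_apply, smul_eq_mul]
    congr 2
    funext i
    split_ifs <;> rfl
  exact h5.unique (h3.mul_left _)

end SeveralVariables

/-! ### The forms in coordinates -/

theorem analyticAt_coord (i : Fin 3) (P : C3) : AnalyticAt ℂ (fun Q : C3 => Q i) P :=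
  (ContinuousLinearMap.proj (R := ℂ) (φ := fun _ : Fin 3 => ℂ) i).analyticAt P

theorem analyticAt_mon (a b : ℕ) (P : C3) : AnalyticAt ℂ (mon a b) P :=
  ((analyticAt_coord 0 P).pow a).mul ((analyticAt_coord 1 P).pow b)

theorem mon_zero {a b : ℕ} (hab : 1 ≤ a + b) : mon a b 0 = 0 := by
  have : a ≠ 0 ∨ b ≠ 0 := by omega
  rcases this with h | h <;> simp [mon, h]

theorem tendsto_mon {a b : ℕ} (hab : 1 ≤ a + b) : Tendsto (mon a b) (𝓝 0) (𝓝 0) := by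
  have := (analyticAt_mon a b 0).continuousAt.tendsto
  rwa [mon_zero hab] at this

theorem analyticAt_comp_mon {a b : ℕ} (hab : 1 ≤ a + b) {f : ℂ → ℂ} (hf : AnalyticAt ℂ f 0) :
    AnalyticAt ℂ (fun P => f (mon a b P)) 0 :=
  AnalyticAt.fun_comp (by rwa [mon_zero hab]) (analyticAt_mon a b 0)

theorem hasFDerivAt_mon (a b : ℕ) (P : C3) : HasFDerivAt (mon a b) (fderiv ℂ (mon a b) P) P :=
  (analyticAt_mon a b P).differentiableAt.hasFDerivAt

theorem fderiv_mon_single (a b : ℕ) (P : C3) : fderiv ℂ (mon a b) P (Pi.single 2 1) = 0 := by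
  have h4 : HasDerivAt (fun s : ℂ => P + s • (Pi.single 2 1 : C3)) (Pi.single 2 1) 0 := by
    simpa using ((hasDerivAt_id (0 : ℂ)).smul_const (Pi.single 2 1 : C3)).const_add P
  have h5 := (hasFDerivAt_mon a b P).comp_hasDerivAt_of_eq (0 : ℂ) h4 (by simp)
  have h6 : (mon a b ∘ fun s : ℂ => P + s • (Pi.single 2 1 : C3)) = fun _ => mon a b P := by
    funext s; simp [mon]
  rw [h6] at h5
  exact h5.unique (hasDerivAt_const _ _)

theorem hasFDerivAt_z (P : C3) : HasFDerivAt (fun Q : C3 => Q 2) dz P :=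
  (ContinuousLinearMap.proj (R := ℂ) (φ := fun _ : Fin 3 => ℂ) 2).hasFDerivAt

theorem fderiv_surf (a b r : ℕ) (P : C3) : fderiv ℂ (surf a b r) P =
    (2 * P 2) • dz + ((r : ℂ) * mon a b P ^ (r - 1)) • fderiv ℂ (mon a b) P := by
  have := ((hasFDerivAt_z P).pow 2).add ((hasFDerivAt_mon a b P).pow r)
  refine this.fderiv.trans ?_
  ext v
  simp

theorem cuspForm_apply (a b d k : ℕ) (h : ℂ → ℂ) (P v : C3) : cuspForm a b d k h P v =
    (2 * P 2 + mon a b P ^ k * h (mon a b P)) * v 2 +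
      d * mon a b P ^ (d - 1) * fderiv ℂ (mon a b) P v := by
  simp only [cuspForm, fderiv_surf, _root_.add_apply, _root_.smul_apply, smul_eq_mul]
  simp only [dz, ContinuousLinearMap.proj_apply]
  ring

theorem analyticAt_fderiv_apply {f : C3 → ℂ} (hf : AnalyticAt ℂ f 0) (v : C3) :
    AnalyticAt ℂ (fun P => fderiv ℂ f P v) 0 :=
  ((ContinuousLinearMap.apply ℂ ℂ v).analyticAt _).comp hf.fderiv

theorem analyticAt_cuspForm_apply {a b : ℕ} (hab : 1 ≤ a + b) (d k : ℕ) {h : ℂ → ℂ}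
    (hh : AnalyticAt ℂ h 0) (v : C3) : AnalyticAt ℂ (fun P => cuspForm a b d k h P v) 0 := by
  simp only [cuspForm_apply]
  have h1 := analyticAt_coord 2 0
  have h2 := analyticAt_mon a b 0
  have h3 := analyticAt_comp_mon hab hh
  have h4 := analyticAt_fderiv_apply h2 v
  exact (((analyticAt_const.mul h1).add ((h2.pow k).mul h3)).mul analyticAt_const).add
    ((analyticAt_const.mul (h2.pow (d - 1))).mul h4)

/-! ### Invariance -/

/-- `f` divides `ω ∧ df`. Other than in `IsInvariantEquation`, `f` may be a unit. -/
def DividesWedge (ω : OneForm) (f : C3 → ℂ) : Prop :=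
  ∀ v w : C3, ∃ c : C3 → ℂ, AnalyticAt ℂ c 0 ∧
    ∀ᶠ P in 𝓝 (0 : C3), ω P v * fderiv ℂ f P w - ω P w * fderiv ℂ f P v = f P * c P

/-- Since `ω ∧ d(F g) = F (ω ∧ dg) + g (ω ∧ dF)`, invariance passes to the quotient by an invariant
factor. -/
theorem DividesWedge.of_mul {ω : OneForm} {f g F : C3 → ℂ}
    (hω : ∀ v, AnalyticAt ℂ (fun P => ω P v) 0) (hf : DividesWedge ω f) (hF : DividesWedge ω F)
    (hFa : AnalyticAt ℂ F 0) (hga : AnalyticAt ℂ g 0) (hF0 : ¬ ∀ᶠ P in 𝓝 (0 : C3), F P = 0)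
    (hfg : ∀ᶠ P in 𝓝 (0 : C3), f P = F P * g P) : DividesWedge ω g := by
  intro v w
  obtain ⟨c, hc, hcf⟩ := hf v w
  obtain ⟨c', hc', hcF⟩ := hF v w
  refine ⟨fun P => c P - c' P, hc.sub hc', ?_⟩
  refine eventually_eq_of_mul hFa (((hω v).mul (analyticAt_fderiv_apply hga w)).sub
    ((hω w).mul (analyticAt_fderiv_apply hga v))) (hga.mul (hc.sub hc')) ?_ hF0
  filter_upwards [hcf, hcF, hfg, hfg.eventually_nhds, hFa.eventually_analyticAt,
    hga.eventually_analyticAt] with P e1 e2 e3 e4 a1 a2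
  have hd : ∀ x, fderiv ℂ f P x = F P * fderiv ℂ g P x + g P * fderiv ℂ F P x := by
    intro x
    rw [EventuallyEq.fderiv_eq e4, fderiv_fun_mul a1.differentiableAt a2.differentiableAt]
    simp
  rw [hd, hd, e3] at e1
  linear_combination e1 - g P * e2

/-- `ζ` parametrizes an invariant curve `z = ζ(u)` of `d (z² + u ^ d) + u ^ k h(u) dz`. -/
def IsSolution (d k : ℕ) (h ζ : ℂ → ℂ) : Prop :=
  ∀ᶠ u in 𝓝 (0 : ℂ), (2 * ζ u + u ^ k * h u) * deriv ζ u + d * u ^ (d - 1) = 0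

theorem hasFDerivAt_graph {a b : ℕ} {ζ : ℂ → ℂ} {P : C3} (hζ : AnalyticAt ℂ ζ (mon a b P)) :
    HasFDerivAt (fun P => P 2 - ζ (mon a b P))
      (dz - deriv ζ (mon a b P) • fderiv ℂ (mon a b) P) P :=
  (hasFDerivAt_z P).sub (hζ.differentiableAt.hasDerivAt.comp_hasFDerivAt P (hasFDerivAt_mon a b P))

theorem dividesWedge_graph {a b d k : ℕ} (hab : 1 ≤ a + b) {h ζ : ℂ → ℂ}
    (hζ : AnalyticAt ℂ ζ 0) (hsol : IsSolution d k h ζ) :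
    DividesWedge (cuspForm a b d k h) (fun P => P 2 - ζ (mon a b P)) := by
  intro v w
  refine ⟨fun P => 2 * deriv ζ (mon a b P) *
    (w 2 * fderiv ℂ (mon a b) P v - v 2 * fderiv ℂ (mon a b) P w), ?_, ?_⟩
  · exact (analyticAt_const.mul (analyticAt_comp_mon hab hζ.deriv)).mul
      ((analyticAt_const.mul (analyticAt_fderiv_apply (analyticAt_mon a b 0) v)).sub
        (analyticAt_const.mul (analyticAt_fderiv_apply (analyticAt_mon a b 0) w)))
  · filter_upwards [(tendsto_mon hab).eventually hsol,
      (tendsto_mon hab).eventually hζ.eventually_analyticAt] with P e1 a1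
    rw [(hasFDerivAt_graph a1).fderiv, cuspForm_apply, cuspForm_apply]
    simp only [_root_.sub_apply, _root_.smul_apply, smul_eq_mul, dz, ContinuousLinearMap.proj_apply]
    linear_combination (w 2 * fderiv ℂ (mon a b) P v - v 2 * fderiv ℂ (mon a b) P w) * e1

theorem graph_not_eventually_zero {a b : ℕ} (hab : 1 ≤ a + b) {ζ : ℂ → ℂ}
    (hζ : AnalyticAt ℂ ζ 0) : ¬ ∀ᶠ P in 𝓝 (0 : C3), P 2 - ζ (mon a b P) = 0 := by
  intro hcon
  have h1 : HasFDerivAt (fun P : C3 => P 2 - ζ (mon a b P)) 0 0 :=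
    (hasFDerivAt_const (𝕜 := ℂ) (0 : ℂ) (0 : C3)).congr_of_eventuallyEq hcon
  have h2 := (hasFDerivAt_graph (a := a) (b := b) (P := 0) (ζ := ζ)
    (by rwa [mon_zero hab])).unique h1
  have h4 := congrArg (fun L : C3 →L[ℂ] ℂ => L (Pi.single 2 1)) h2
  simp [dz, fderiv_mon_single] at h4

/-- An analytic germ that vanishes on the graph `z = ζ(u)` is divisible by its equation. -/
theorem exists_graph_quotient {a b : ℕ} (hab : 1 ≤ a + b) {ζ : ℂ → ℂ} (hζ : AnalyticAt ℂ ζ 0)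
    (hζ0 : ζ 0 = 0) {f : C3 → ℂ} (hf : AnalyticAt ℂ f 0)
    (hfz : ∀ᶠ ξ in 𝓝 (0 : ℂ × ℂ), f ![ξ.1, ξ.2, ζ (ξ.1 ^ a * ξ.2 ^ b)] = 0) :
    ∃ g : C3 → ℂ, AnalyticAt ℂ g 0 ∧ ∀ᶠ P in 𝓝 (0 : C3), f P = (P 2 - ζ (mon a b P)) * g P := by
  -- The shear `Ψ` takes the plane `z = 0` to the graph, and `Ψ'` is its inverse.
  set e : C3 := Pi.single 2 1 with he
  have hmon : ∀ (P : C3) (c : ℂ), mon a b (P + c • e) = mon a b P := by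
    intro P c; simp [mon, he]
  have hζm := analyticAt_comp_mon hab hζ
  set Ψ : C3 → C3 := fun P => P + ζ (mon a b P) • e with hΨ
  set Ψ' : C3 → C3 := fun P => P + (-ζ (mon a b P)) • e with hΨ'
  have hΨa : AnalyticAt ℂ Ψ 0 := analyticAt_id.add (hζm.smul analyticAt_const)
  have hΨa' : AnalyticAt ℂ Ψ' 0 := analyticAt_id.add (hζm.neg.smul analyticAt_const)
  have hΨ0 : Ψ 0 = 0 := by simp [hΨ, mon_zero hab, hζ0]
  have hΨ0' : Ψ' 0 = 0 := by simp [hΨ', mon_zero hab, hζ0]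
  have hΨt' : Tendsto Ψ' (𝓝 0) (𝓝 0) := by simpa [ContinuousAt, hΨ0'] using hΨa'.continuousAt
  set π : C3 →L[ℂ] C3 := ContinuousLinearMap.id ℂ C3 - dz.smulRight e with hπ
  obtain ⟨g, hg, hgf⟩ := exists_hadamard_quotient (f := f ∘ Ψ)
    (AnalyticAt.comp (by rwa [hΨ0]) hΨa) π e dz (by intro P; simp [hπ])
  refine ⟨g ∘ Ψ', AnalyticAt.comp (by rwa [hΨ0']) hΨa', ?_⟩
  have hξ : Tendsto (fun P : C3 => (P 0, P 1)) (𝓝 0) (𝓝 (0 : ℂ × ℂ)) := by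
    have : Continuous (fun P : C3 => (P 0, P 1)) := by fun_prop
    exact this.tendsto' 0 0 rfl
  filter_upwards [hΨt'.eventually hgf, hξ.eventually hfz] with P e1 e2
  have h1 : Ψ (Ψ' P) = P := by
    simp only [hΨ, hΨ', hmon]
    rw [add_assoc, ← add_smul]; simp
  have h2 : Ψ (π (Ψ' P)) = ![P 0, P 1, ζ (P 0 ^ a * P 1 ^ b)] := by
    have h3 : π (Ψ' P) = Ψ' P + (-(dz (Ψ' P))) • e := by simp [hπ, sub_eq_add_neg]
    rw [h3]
    simp only [hΨ, hmon, hΨ']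
    ext i
    fin_cases i <;> simp [he, dz, mon]
  simp only [Function.comp_apply, h1, h2, e2, sub_zero] at e1
  rw [e1]
  simp [hΨ', dz, he, sub_eq_add_neg]

/-! ### Invariant hypersurfaces -/

theorem hasDerivAt_curve {x₁ y₁ c s : ℂ} {g : ℂ → ℂ} (hg : HasDerivAt g c s) :
    HasDerivAt (fun s => (![s * x₁, s * y₁, g s] : C3)) ![x₁, y₁, c] s := by
  rw [hasDerivAt_pi]
  intro i
  fin_cases i
  · simpa using (hasDerivAt_id s).mul_const x₁
  · simpa using (hasDerivAt_id s).mul_const y₁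
  · simpa using hg

/-- The derivative of an invariant `f` along a curve `s ↦ (x₁ s, y₁ s, ζ(u))` on an invariant graph.
The form `Ω` vanishes on the velocity of this curve, so the evaluation of `Ω ∧ df` on `∂/∂z` and on
the velocity is the product of `Ω(∂/∂z) = 2 z + u ^ k h(u)` with the derivative of `f`. -/
theorem deriv_along_invariant_curve {a b d k : ℕ} (hab : 1 ≤ a + b) {h ζ : ℂ → ℂ}
    (hζ : AnalyticAt ℂ ζ 0) (hζ0 : ζ 0 = 0) (hsol : IsSolution d k h ζ) {f cx cy : C3 → ℂ}
    (hf : AnalyticAt ℂ f 0)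
    (hx : ∀ᶠ P in 𝓝 (0 : C3), cuspForm a b d k h P (Pi.single 2 1) * fderiv ℂ f P (Pi.single 0 1) -
      cuspForm a b d k h P (Pi.single 0 1) * fderiv ℂ f P (Pi.single 2 1) = f P * cx P)
    (hy : ∀ᶠ P in 𝓝 (0 : C3), cuspForm a b d k h P (Pi.single 2 1) * fderiv ℂ f P (Pi.single 1 1) -
      cuspForm a b d k h P (Pi.single 1 1) * fderiv ℂ f P (Pi.single 2 1) = f P * cy P)
    (x₁ y₁ : ℂ) {γ : ℂ → C3}
    (hγ : γ = fun s => ![s * x₁, s * y₁, ζ ((s * x₁) ^ a * (s * y₁) ^ b)]) :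
    AnalyticAt ℂ γ 0 ∧ γ 0 = 0 ∧ ∀ᶠ s in 𝓝 (0 : ℂ),
      (2 * γ s 2 + mon a b (γ s) ^ k * h (mon a b (γ s))) * deriv (fun s => f (γ s)) s =
        f (γ s) * (x₁ * cx (γ s) + y₁ * cy (γ s)) := by
  set U : ℂ → ℂ := fun s => (s * x₁) ^ a * (s * y₁) ^ b with hU
  have hU0 : U 0 = 0 := by
    have : a ≠ 0 ∨ b ≠ 0 := by omega
    rcases this with h | h <;> simp [hU, h]
  have hUa : ∀ s, AnalyticAt ℂ U s := fun s => by
    simp only [hU]; fun_prop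
  have hUt : Tendsto U (𝓝 0) (𝓝 0) := by simpa [ContinuousAt, hU0] using (hUa 0).continuousAt
  have hγ0 : γ 0 = 0 := by
    rw [hγ]
    ext i
    fin_cases i
    · simp
    · simp
    · change ζ (U 0) = 0
      rw [hU0, hζ0]
  have hγa : AnalyticAt ℂ γ 0 := by
    rw [hγ, analyticAt_pi_iff]
    intro i
    fin_cases i
    · exact analyticAt_id.mul analyticAt_const
    · exact analyticAt_id.mul analyticAt_const
    · change AnalyticAt ℂ (fun s => ζ (U s)) 0
      exact AnalyticAt.fun_comp (by rwa [hU0]) (hUa 0)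
  have hγt : Tendsto γ (𝓝 0) (𝓝 0) := by simpa [ContinuousAt, hγ0] using hγa.continuousAt
  refine ⟨hγa, hγ0, ?_⟩
  have hmon : ∀ s, mon a b (γ s) = U s := by intro s; simp [hγ, mon, hU]
  filter_upwards [hγt.eventually hx, hγt.eventually hy, hγt.eventually hf.eventually_analyticAt,
    hUt.eventually hsol, hUt.eventually hζ.eventually_analyticAt] with s e1 e2 a1 e3 a2
  have hU' := (hUa s).differentiableAt.hasDerivAt
  have hγ' : HasDerivAt γ ![x₁, y₁, deriv ζ (U s) * deriv U s] s := by
    rw [hγ]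
    exact hasDerivAt_curve (a2.differentiableAt.hasDerivAt.comp s hU')
  have hdf := (a1.differentiableAt.hasFDerivAt.comp_hasDerivAt s hγ').deriv
  have hdu : fderiv ℂ (mon a b) (γ s) ![x₁, y₁, deriv ζ (U s) * deriv U s] = deriv U s := by
    have h1 := (hasFDerivAt_mon a b (γ s)).comp_hasDerivAt s hγ'
    have h2 : mon a b ∘ γ = U := funext hmon
    rw [h2] at h1
    exact h1.unique hU'
  have hvec : (![x₁, y₁, deriv ζ (U s) * deriv U s] : C3) = x₁ • Pi.single 0 1 +
      y₁ • Pi.single 1 1 + (deriv ζ (U s) * deriv U s) • Pi.single 2 1 := by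
    ext i
    fin_cases i <;> simp
  have hγ2 : γ s 2 = ζ (U s) := by simp [hγ, hU]
  change _ * deriv (f ∘ γ) s = _
  rw [hdf]
  have hΩ := cuspForm_apply a b d k h (γ s) ![x₁, y₁, deriv ζ (U s) * deriv U s]
  have hv2 : (![x₁, y₁, deriv ζ (U s) * deriv U s] : C3) 2 = deriv ζ (U s) * deriv U s := rfl
  rw [hdu, hv2, hvec] at hΩ
  rw [hvec]
  have hΩ2 := cuspForm_apply a b d k h (γ s) (Pi.single 2 1)
  rw [fderiv_mon_single] at hΩ2
  simp only [map_add, map_smul, smul_eq_mul] at hΩ ⊢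
  rw [Pi.single_eq_same, mul_one, mul_zero, add_zero] at hΩ2
  simp only [hmon, hγ2] at hΩ hΩ2 ⊢
  linear_combination x₁ * e1 + y₁ * e2 + fderiv ℂ f (γ s) (Pi.single 2 1) * hΩ +
    fderiv ℂ f (γ s) (Pi.single 2 1) * deriv U s * e3 -
    (x₁ * fderiv ℂ f (γ s) (Pi.single 0 1) + y₁ * fderiv ℂ f (γ s) (Pi.single 1 1) +
      deriv ζ (U s) * deriv U s * fderiv ℂ f (γ s) (Pi.single 2 1)) * hΩ2

/-- If `s ^ m q φ' = φ C`, the coefficient of `s ^ (m - 1)` in `C` is `n q(0)`, where `n` is the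
order of `φ`: it is the residue of the logarithmic derivative of `φ`. -/
theorem logarithmic_order {φ q C : ℂ → ℂ} {m : ℕ} (hm : 1 ≤ m) (hφ : AnalyticAt ℂ φ 0)
    (hφ0 : φ 0 = 0) (hφn : ¬ ∀ᶠ s in 𝓝 (0 : ℂ), φ s = 0) (hq : ContinuousAt q 0)
    (heq : ∀ᶠ s in 𝓝 (0 : ℂ), s ^ m * q s * deriv φ s = φ s * C s) :
    ∃ n : ℕ, 1 ≤ n ∧ ∃ Q : ℂ → ℂ, ContinuousAt Q 0 ∧ Q 0 = n * q 0 ∧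
      ∀ᶠ s in 𝓝 (0 : ℂ), s ^ m * Q s = s * C s := by
  obtain ⟨n, ψ, hψ, hψ0, hn⟩ := hφ.exists_eventuallyEq_pow_smul_nonzero_iff.2 hφn
  simp only [sub_zero, smul_eq_mul] at hn
  have hn1 : 1 ≤ n := by
    by_contra hn0
    obtain rfl : n = 0 := by omega
    have := hn.self_of_nhds
    simp [hφ0] at this
    exact hψ0 this.symm
  refine ⟨n, hn1, fun s => q s * (n + s * deriv ψ s / ψ s), ?_, by simp [mul_comm], ?_⟩
  · have h1 := hψ.continuousAt
    have h2 := hψ.deriv.continuousAt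
    exact hq.mul (continuousAt_const.add ((continuousAt_id.mul h2).div h1 hψ0))
  · filter_upwards [heq, hn, hn.eventually_nhds, hψ.eventually_analyticAt,
      hψ.continuousAt.eventually_ne hψ0] with s e1 e2 e3 a1 hne
    by_cases hs : s = 0
    · simp [hs, show m ≠ 0 by omega]
    have hd : deriv φ s = n * s ^ (n - 1) * ψ s + s ^ n * deriv ψ s := by
      rw [EventuallyEq.deriv_eq e3]
      simpa using (((hasDerivAt_pow n s).fun_mul a1.differentiableAt.hasDerivAt).deriv)
    have hp : s * s ^ (n - 1) = s ^ n := by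
      rw [← pow_succ']; congr 1; omega
    have hsn := pow_ne_zero n hs
    rw [hd, e2] at e1
    field_simp
    refine mul_left_cancel₀ hsn ?_
    linear_combination s * e1 - s ^ m * q s * n * ψ s * hp

/-- The index argument: an invariant germ whose hypersurface passes through the origin
vanishes on one of the two invariant graphs `z = u ^ e * tᵢ(u)`, unless a resonance occurs. -/
theorem vanishes_on_graph {a b d k e : ℕ} (hab : 1 ≤ a + b) (he : 1 ≤ e) {h G t₁ t₂ : ℂ → ℂ}
    (hG : AnalyticAt ℂ G 0) (hhG : ∀ᶠ u in 𝓝 (0 : ℂ), u ^ k * h u = u ^ e * G u)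
    (ht₁ : AnalyticAt ℂ t₁ 0) (ht₂ : AnalyticAt ℂ t₂ 0)
    (hs₁ : IsSolution d k h fun u => u ^ e * t₁ u) (hs₂ : IsSolution d k h fun u => u ^ e * t₂ u)
    (hres : ∀ m n : ℕ, 1 ≤ m → 1 ≤ n → m * (2 * t₁ 0 + G 0) ≠ n * (2 * t₂ 0 + G 0))
    {f : C3 → ℂ} (hf : AnalyticAt ℂ f 0) (hf0 : f 0 = 0)
    (hinv : DividesWedge (cuspForm a b d k h) f) :
    (∀ᶠ ξ in 𝓝 (0 : ℂ × ℂ), f ![ξ.1, ξ.2, (ξ.1 ^ a * ξ.2 ^ b) ^ e * t₁ (ξ.1 ^ a * ξ.2 ^ b)] = 0) ∨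
    (∀ᶠ ξ in 𝓝 (0 : ℂ × ℂ), f ![ξ.1, ξ.2, (ξ.1 ^ a * ξ.2 ^ b) ^ e * t₂ (ξ.1 ^ a * ξ.2 ^ b)] = 0) := by
  by_contra hcon
  rw [not_or] at hcon
  obtain ⟨hcon₁, hcon₂⟩ := hcon
  have he0 : e ≠ 0 := by omega
  have hab0 : a ≠ 0 ∨ b ≠ 0 := by omega
  set W : ℂ × ℂ → ℂ := fun ξ => ξ.1 ^ a * ξ.2 ^ b with hW
  have hWa : AnalyticAt ℂ W 0 := (analyticAt_fst.pow a).mul (analyticAt_snd.pow b)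
  have hW0 : W 0 = 0 := by rcases hab0 with h | h <;> simp [hW, h]
  have key : ∀ t : ℂ → ℂ, AnalyticAt ℂ t 0 →
      AnalyticAt ℂ (fun ξ : ℂ × ℂ => f ![ξ.1, ξ.2, W ξ ^ e * t (W ξ)]) 0 := by
    intro t ht
    have h1 : (![(0 : ℂ × ℂ).1, (0 : ℂ × ℂ).2, W 0 ^ e * t (W 0)] : C3) = 0 := by
      ext i; fin_cases i <;> simp [hW0, he0]
    refine AnalyticAt.fun_comp (g := f) (f := fun ξ : ℂ × ℂ => ![ξ.1, ξ.2, W ξ ^ e * t (W ξ)])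
      (by rwa [h1]) ?_
    rw [analyticAt_pi_iff]
    intro i
    fin_cases i
    · exact analyticAt_fst
    · exact analyticAt_snd
    · exact (hWa.pow e).mul (AnalyticAt.fun_comp (by rwa [hW0]) hWa)
  have hWn : ¬ ∀ᶠ ξ in 𝓝 (0 : ℂ × ℂ), W ξ = 0 := by
    intro hc
    have h1 : Tendsto (fun s : ℂ => (s, s)) (𝓝[≠] 0) (𝓝 (0 : ℂ × ℂ)) :=
      ((continuous_id.prodMk continuous_id).tendsto' (0 : ℂ) 0 rfl).mono_left nhdsWithin_le_nhds
    obtain ⟨s, hs, hs0⟩ := ((h1.eventually hc).and self_mem_nhdsWithin).exists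
    have hs0' : s ≠ 0 := hs0
    simp [hW, hs0'] at hs
  -- A line on which none of `f ∘ graph₁`, `f ∘ graph₂`, `u` vanishes identically.
  have hprod : ¬ ∀ᶠ ξ in 𝓝 (0 : ℂ × ℂ), f ![ξ.1, ξ.2, W ξ ^ e * t₁ (W ξ)] *
      (f ![ξ.1, ξ.2, W ξ ^ e * t₂ (W ξ)] * W ξ) = 0 := by
    intro hc
    exact hWn (eventually_eq_zero_of_mul (key t₂ ht₂) hWa
      (eventually_eq_zero_of_mul (key t₁ ht₁) ((key t₂ ht₂).mul hWa) hc hcon₁) hcon₂)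
  obtain ⟨⟨x₁, y₁⟩, hline⟩ := exists_line_not_eventually_zero
    ((key t₁ ht₁).mul ((key t₂ ht₂).mul hWa)) hprod
  replace hline : ¬ ∀ᶠ s in 𝓝 (0 : ℂ),
      f ![s * x₁, s * y₁, W (s * x₁, s * y₁) ^ e * t₁ (W (s * x₁, s * y₁))] *
      (f ![s * x₁, s * y₁, W (s * x₁, s * y₁) ^ e * t₂ (W (s * x₁, s * y₁))] *
        W (s * x₁, s * y₁)) = 0 := hline
  set ν : ℂ := x₁ ^ a * y₁ ^ b with hν
  have hWs : ∀ s : ℂ, W (s * x₁, s * y₁) = ν * s ^ (a + b) := by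
    intro s; simp only [hW, hν]; ring
  have hν0 : ν ≠ 0 := by
    intro h0
    exact hline (Eventually.of_forall fun s => by simp [hWs, h0])
  obtain ⟨cx, hcx, hx⟩ := hinv (Pi.single 2 1) (Pi.single 0 1)
  obtain ⟨cy, hcy, hy⟩ := hinv (Pi.single 2 1) (Pi.single 1 1)
  set C : C3 → ℂ := fun P => x₁ * cx P + y₁ * cy P with hC
  have hCa : AnalyticAt ℂ C 0 := (analyticAt_const.mul hcx).add (analyticAt_const.mul hcy)
  have hUt : Tendsto (fun s : ℂ => ν * s ^ (a + b)) (𝓝 0) (𝓝 0) := by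
    have : Continuous (fun s : ℂ => ν * s ^ (a + b)) := by fun_prop
    exact this.tendsto' 0 0 (by simp; omega)
  have hν00 : ν * (0 : ℂ) ^ (a + b) = 0 := by simp; omega
  have hm : 1 ≤ (a + b) * e := Nat.one_le_iff_ne_zero.2 (by positivity)
  have curve : ∀ t : ℂ → ℂ, AnalyticAt ℂ t 0 → IsSolution d k h (fun u => u ^ e * t u) →
      (¬ ∀ᶠ s in 𝓝 (0 : ℂ),
        f ![s * x₁, s * y₁, W (s * x₁, s * y₁) ^ e * t (W (s * x₁, s * y₁))] = 0) →
      ∃ γ : ℂ → C3, Tendsto γ (𝓝 0) (𝓝 0) ∧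
        (∀ s, γ s = ![s * x₁, s * y₁, (ν * s ^ (a + b)) ^ e * t (ν * s ^ (a + b))]) ∧
        ∃ n : ℕ, 1 ≤ n ∧ ∃ Q : ℂ → ℂ, ContinuousAt Q 0 ∧
          Q 0 = n * (ν ^ e * (2 * t 0 + G 0)) ∧
          ∀ᶠ s in 𝓝 (0 : ℂ), s ^ ((a + b) * e) * Q s = s * C (γ s) := by
    intro t ht hs hn
    set γ : ℂ → C3 := fun s => ![s * x₁, s * y₁,
      ((s * x₁) ^ a * (s * y₁) ^ b) ^ e * t ((s * x₁) ^ a * (s * y₁) ^ b)] with hγdef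
    obtain ⟨hγa, hγ0, hγ⟩ := deriv_along_invariant_curve hab (ζ := fun u => u ^ e * t u)
      ((analyticAt_id.pow e).mul ht) (by simp [he0]) hs hf hx hy x₁ y₁ hγdef
    have hγt : Tendsto γ (𝓝 0) (𝓝 0) := by
      have := hγa.continuousAt.tendsto
      rwa [hγ0] at this
    have hU : ∀ s, (s * x₁) ^ a * (s * y₁) ^ b = ν * s ^ (a + b) := hWs
    have hγs : ∀ s, γ s = ![s * x₁, s * y₁, (ν * s ^ (a + b)) ^ e * t (ν * s ^ (a + b))] := by
      intro s; simp only [hγdef, hU]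
    refine ⟨γ, hγt, hγs, ?_⟩
    have hmon : ∀ s, mon a b (γ s) = ν * s ^ (a + b) := by
      intro s; rw [← hU]; simp [hγdef, mon]
    have hfγ : AnalyticAt ℂ (fun s => f (γ s)) 0 := AnalyticAt.fun_comp (by rwa [hγ0]) hγa
    have hcq : ContinuousAt
        (fun s => ν ^ e * (2 * t (ν * s ^ (a + b)) + G (ν * s ^ (a + b)))) 0 := by
      have hcomp : ∀ {g : ℂ → ℂ}, ContinuousAt g 0 →
          ContinuousAt (fun s => g (ν * s ^ (a + b))) 0 := by
        intro g hg
        change Tendsto _ _ (𝓝 (g (ν * 0 ^ (a + b))))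
        rw [hν00]
        exact hg.tendsto.comp hUt
      exact continuousAt_const.mul ((continuousAt_const.mul (hcomp ht.continuousAt)).add
        (hcomp hG.continuousAt))
    obtain ⟨n, hn1, Q, hQ, hQ0, hQs⟩ := logarithmic_order (C := fun s => C (γ s)) hm hfγ
      (by simp [hγ0, hf0]) hn hcq (by
        filter_upwards [hγ, hUt.eventually hhG] with s e1 e2
        rw [← e1, hmon, e2, hγs]
        simp only [Matrix.cons_val]
        ring)
    refine ⟨n, hn1, Q, hQ, ?_, hQs⟩
    rw [hQ0, hν00]
  obtain ⟨γ₁, hγ₁, hγs₁, m, hm1, Q₁, hQ₁, hQ₁0, hQs₁⟩ := curve t₁ ht₁ hs₁ fun hc =>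
    hline (hc.mono fun s hs => by rw [hs, zero_mul])
  obtain ⟨γ₂, hγ₂, hγs₂, n, hn1, Q₂, hQ₂, hQ₂0, hQs₂⟩ := curve t₂ ht₂ hs₂ fun hc =>
    hline (hc.mono fun s hs => by rw [hs, zero_mul, mul_zero])
  -- The two curves agree up to order `u ^ e`, hence so do the cofactors along them.
  obtain ⟨K, V, hV, hLip⟩ := hCa.hasStrictFDerivAt.exists_lipschitzOnWith
  have hbound : ∀ᶠ s in 𝓝[≠] (0 : ℂ), ‖Q₁ s - Q₂ s‖ ≤
      ‖s‖ * (K * (‖ν‖ ^ e * ‖t₁ (ν * s ^ (a + b)) - t₂ (ν * s ^ (a + b))‖)) := by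
    have hV₁ := hγ₁.eventually (show ∀ᶠ P in 𝓝 (0 : C3), P ∈ V from hV)
    have hV₂ := hγ₂.eventually (show ∀ᶠ P in 𝓝 (0 : C3), P ∈ V from hV)
    filter_upwards [eventually_nhdsWithin_of_eventually_nhds hQs₁,
      eventually_nhdsWithin_of_eventually_nhds hQs₂, eventually_nhdsWithin_of_eventually_nhds hV₁,
      eventually_nhdsWithin_of_eventually_nhds hV₂, self_mem_nhdsWithin] with s e1 e2 v1 v2 hs
    have hs0 : 0 < ‖s ^ ((a + b) * e)‖ := norm_pos_iff.2 (pow_ne_zero _ hs)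
    have h1 := hLip.norm_sub_le v1 v2
    have h2 : ‖γ₁ s - γ₂ s‖ ≤ ‖s ^ ((a + b) * e)‖ *
        (‖ν‖ ^ e * ‖t₁ (ν * s ^ (a + b)) - t₂ (ν * s ^ (a + b))‖) := by
      rw [pi_norm_le_iff_of_nonneg (by positivity)]
      intro i
      rw [hγs₁, hγs₂]
      fin_cases i
      · simp; positivity
      · simp; positivity
      · apply le_of_eq
        simp only [Pi.sub_apply]
        change ‖(ν * s ^ (a + b)) ^ e * t₁ (ν * s ^ (a + b)) -
          (ν * s ^ (a + b)) ^ e * t₂ (ν * s ^ (a + b))‖ = _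
        rw [← mul_sub, norm_mul, mul_pow, norm_mul, norm_pow ν, pow_mul]
        ring
    have h3 : s ^ ((a + b) * e) * (Q₁ s - Q₂ s) = s * (C (γ₁ s) - C (γ₂ s)) := by
      linear_combination e1 - e2
    refine le_of_mul_le_mul_left ?_ hs0
    rw [← norm_mul, h3, norm_mul]
    calc ‖s‖ * ‖C (γ₁ s) - C (γ₂ s)‖ ≤ ‖s‖ * (K * (‖s ^ ((a + b) * e)‖ *
        (‖ν‖ ^ e * ‖t₁ (ν * s ^ (a + b)) - t₂ (ν * s ^ (a + b))‖))) := by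
          gcongr; exact h1.trans (by gcongr)
      _ = _ := by ring
  have hlim : Tendsto (fun s : ℂ =>
      ‖s‖ * (K * (‖ν‖ ^ e * ‖t₁ (ν * s ^ (a + b)) - t₂ (ν * s ^ (a + b))‖))) (𝓝[≠] 0) (𝓝 0) := by
    have h1 : Tendsto (fun s : ℂ => t₁ (ν * s ^ (a + b))) (𝓝 0) (𝓝 (t₁ 0)) :=
      ht₁.continuousAt.tendsto.comp hUt
    have h2 : Tendsto (fun s : ℂ => t₂ (ν * s ^ (a + b))) (𝓝 0) (𝓝 (t₂ 0)) :=
      ht₂.continuousAt.tendsto.comp hUt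
    have h3 : Tendsto (fun s : ℂ => ‖s‖) (𝓝 0) (𝓝 0) := continuous_norm.tendsto' 0 0 norm_zero
    have h4 := h3.mul (((h1.sub h2).norm.const_mul (‖ν‖ ^ e)).const_mul (K : ℝ))
    rw [zero_mul] at h4
    exact h4.mono_left nhdsWithin_le_nhds
  have h1 : Tendsto (fun s => Q₁ s - Q₂ s) (𝓝[≠] 0) (𝓝 0) := squeeze_zero_norm' hbound hlim
  have h2 : Tendsto (fun s => Q₁ s - Q₂ s) (𝓝[≠] 0) (𝓝 (Q₁ 0 - Q₂ 0)) :=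
    (hQ₁.sub hQ₂).tendsto.mono_left nhdsWithin_le_nhds
  have h3 := tendsto_nhds_unique h2 h1
  rw [hQ₁0, hQ₂0] at h3
  refine hres m n hm1 hn1 (mul_left_cancel₀ (pow_ne_zero e hν0) ?_)
  linear_combination h3

/-- All invariant hypersurfaces are contained in the union of the two invariant graphs. -/
theorem zero_mem_graphs {a b d k e : ℕ} (hab : 1 ≤ a + b) (he : 1 ≤ e) {h G t₁ t₂ : ℂ → ℂ}
    (hh : AnalyticAt ℂ h 0)
    (hG : AnalyticAt ℂ G 0) (hhG : ∀ᶠ u in 𝓝 (0 : ℂ), u ^ k * h u = u ^ e * G u)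
    (ht₁ : AnalyticAt ℂ t₁ 0) (ht₂ : AnalyticAt ℂ t₂ 0)
    (hs₁ : IsSolution d k h fun u => u ^ e * t₁ u) (hs₂ : IsSolution d k h fun u => u ^ e * t₂ u)
    (hres : ∀ m n : ℕ, 1 ≤ m → 1 ≤ n → m * (2 * t₁ 0 + G 0) ≠ n * (2 * t₂ 0 + G 0))
    {f : C3 → ℂ} (hf : AnalyticAt ℂ f 0) (hf0 : ¬ ∀ᶠ P in 𝓝 (0 : C3), f P = 0)
    (hinv : DividesWedge (cuspForm a b d k h) f) :
    ∀ᶠ P in 𝓝 (0 : C3), f P = 0 →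
      (P 2 - mon a b P ^ e * t₁ (mon a b P)) * (P 2 - mon a b P ^ e * t₂ (mon a b P)) = 0 := by
  obtain ⟨P₁, hP₁⟩ := exists_line_not_eventually_zero hf hf0
  have hline : ∀ {g : C3 → ℂ}, AnalyticAt ℂ g 0 → AnalyticAt ℂ (fun s : ℂ => g (s • P₁)) 0 :=
    fun hg => AnalyticAt.fun_comp (by simpa using hg) (by fun_prop)
  have hlt : Tendsto (fun s : ℂ => s • P₁) (𝓝 0) (𝓝 0) := by
    have : Continuous (fun s : ℂ => s • P₁) := by fun_prop
    exact this.tendsto' 0 0 (by simp)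
  obtain ⟨n, hn⟩ := ENat.ne_top_iff_exists.1 (fun ht => hP₁ (analyticOrderAt_eq_top.1 ht))
  clear hf0 hP₁
  induction n using Nat.strong_induction_on generalizing f with
  | _ n ih =>
    by_cases hf0 : f 0 = 0
    swap
    · filter_upwards [hf.continuousAt.eventually_ne hf0] with P h1 h2
      exact absurd h2 h1
    have hstep : ∀ t : ℂ → ℂ, AnalyticAt ℂ t 0 → IsSolution d k h (fun u => u ^ e * t u) →
        (∀ᶠ ξ in 𝓝 (0 : ℂ × ℂ),
          f ![ξ.1, ξ.2, (ξ.1 ^ a * ξ.2 ^ b) ^ e * t (ξ.1 ^ a * ξ.2 ^ b)] = 0) →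
        ∀ᶠ P in 𝓝 (0 : C3), f P = 0 → P 2 - mon a b P ^ e * t (mon a b P) ≠ 0 →
        (P 2 - mon a b P ^ e * t₁ (mon a b P)) * (P 2 - mon a b P ^ e * t₂ (mon a b P)) = 0 := by
      intro t ht hs hvan
      have hζ : AnalyticAt ℂ (fun u => u ^ e * t u) 0 := (analyticAt_id.pow e).mul ht
      have hζ0 : (fun u => u ^ e * t u) 0 = 0 := by simp [show e ≠ 0 by omega]
      obtain ⟨g, hg, hgf⟩ := exists_graph_quotient hab hζ hζ0 hf hvan
      have hFa : AnalyticAt ℂ (fun P => P 2 - mon a b P ^ e * t (mon a b P)) 0 :=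
        (analyticAt_coord 2 0).sub (analyticAt_comp_mon hab hζ)
      have hginv : DividesWedge (cuspForm a b d k h) g :=
        hinv.of_mul (analyticAt_cuspForm_apply hab d k hh) (dividesWedge_graph hab hζ hs) hFa hg
          (graph_not_eventually_zero hab hζ) hgf
      have hord : analyticOrderAt (fun s : ℂ => f (s • P₁)) 0 =
          analyticOrderAt (fun s : ℂ => (fun P => P 2 - mon a b P ^ e * t (mon a b P)) (s • P₁)) 0 +
            analyticOrderAt (fun s : ℂ => g (s • P₁)) 0 := by
        rw [← analyticOrderAt_mul (hline hFa) (hline hg)]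
        exact analyticOrderAt_congr (hlt.eventually hgf)
      have hpos : analyticOrderAt
          (fun s : ℂ => (fun P => P 2 - mon a b P ^ e * t (mon a b P)) (s • P₁)) 0 ≠ 0 := by
        rw [(hline hFa).analyticOrderAt_ne_zero]
        simp [mon_zero hab, show e ≠ 0 by omega]
      rw [← hn] at hord
      generalize hA : analyticOrderAt
          (fun s : ℂ => (fun P => P 2 - mon a b P ^ e * t (mon a b P)) (s • P₁)) 0 = A at hord hpos
      generalize hB : analyticOrderAt (fun s : ℂ => g (s • P₁)) 0 = B at hord
      induction A using ENat.recTopCoe with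
      | top => simp at hord
      | coe A =>
        induction B using ENat.recTopCoe with
        | top => simp at hord
        | coe B =>
          have hord' : n = A + B := by exact_mod_cast hord
          have hpos' : A ≠ 0 := by exact_mod_cast hpos
          have := ih B (by omega) hg hginv hB.symm
          filter_upwards [this, hgf] with P h1 h2 h3 h4
          exact h1 ((mul_eq_zero.1 (h2.symm.trans h3)).resolve_left h4)
    rcases vanishes_on_graph hab he hG hhG ht₁ ht₂ hs₁ hs₂ hres hf hf0 hinv with hv | hv
    · filter_upwards [hstep t₁ ht₁ hs₁ hv] with P h1 h2
      by_contra hne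
      exact hne (h1 h2 (left_ne_zero_of_mul hne))
    · filter_upwards [hstep t₂ ht₂ hs₂ hv] with P h1 h2
      by_contra hne
      exact hne (h1 h2 (right_ne_zero_of_mul hne))

/-! ### The normal form -/

/-- The map `(x, y, z) ↦ (x, y, α(u) z + β(u))`. -/
noncomputable def fiberMap (a b : ℕ) (α β : ℂ → ℂ) (P : C3) : C3 :=
  P + (α (mon a b P) * P 2 + β (mon a b P) - P 2) • Pi.single 2 1

theorem mon_add_single (a b : ℕ) (P : C3) (c : ℂ) :
    mon a b (P + c • Pi.single 2 1) = mon a b P := by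
  simp [mon]

theorem mon_fiberMap (a b : ℕ) (α β : ℂ → ℂ) (P : C3) :
    mon a b (fiberMap a b α β P) = mon a b P := mon_add_single a b P _

theorem fiberMap_two (a b : ℕ) (α β : ℂ → ℂ) (P : C3) :
    fiberMap a b α β P 2 = α (mon a b P) * P 2 + β (mon a b P) := by
  simp [fiberMap]

theorem hasFDerivAt_fiberMap {a b : ℕ} {α β : ℂ → ℂ} {P : C3} (hα : AnalyticAt ℂ α (mon a b P))
    (hβ : AnalyticAt ℂ β (mon a b P)) :
    HasFDerivAt (fiberMap a b α β) (ContinuousLinearMap.id ℂ C3 +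
      ((α (mon a b P) - 1) • dz + (deriv α (mon a b P) * P 2 + deriv β (mon a b P)) •
        fderiv ℂ (mon a b) P).smulRight (Pi.single 2 1)) P := by
  have h1 := hα.differentiableAt.hasDerivAt.comp_hasFDerivAt P (hasFDerivAt_mon a b P)
  have h2 := hβ.differentiableAt.hasDerivAt.comp_hasFDerivAt P (hasFDerivAt_mon a b P)
  have h3 := ((((h1.mul (hasFDerivAt_z P)).add h2).sub (hasFDerivAt_z P)).smul_const
    (Pi.single 2 1 : C3))
  refine ((hasFDerivAt_id P).add h3).congr_fderiv ?_
  ext v i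
  simp [dz]
  left
  ring

theorem isBiholomorphicGerm_fiberMap {a b : ℕ} (hab : 1 ≤ a + b) {α β : ℂ → ℂ}
    (hα : AnalyticAt ℂ α 0) (hβ : AnalyticAt ℂ β 0) (hα0 : α 0 ≠ 0) (hβ0 : β 0 = 0) :
    IsBiholomorphicGerm (fiberMap a b α β) := by
  refine ⟨?_, ?_, ?_⟩
  · exact analyticAt_id.add (((((analyticAt_comp_mon hab hα).mul (analyticAt_coord 2 0)).add
      (analyticAt_comp_mon hab hβ)).sub (analyticAt_coord 2 0)).smul analyticAt_const)
  · simp [fiberMap, mon_zero hab, hβ0]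
  · rw [(hasFDerivAt_fiberMap (P := 0) (by rwa [mon_zero hab]) (by rwa [mon_zero hab])).fderiv]
    simp only [mon_zero hab]
    set L : C3 →L[ℂ] C3 := ContinuousLinearMap.id ℂ C3 +
      ((α 0 - 1) • dz + (deriv α 0 * (0 : C3) 2 + deriv β 0) •
        fderiv ℂ (mon a b) 0).smulRight (Pi.single 2 1) with hL
    have hinj : Function.Injective (L : C3 →ₗ[ℂ] C3) := by
      rw [← LinearMap.ker_eq_bot, LinearMap.ker_eq_bot']
      intro v hv
      have h0 := congrFun hv 0
      have h1 := congrFun hv 1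
      have h2 := congrFun hv 2
      simp [hL] at h0 h1
      have h3 : v = v 2 • Pi.single 2 1 := by
        ext i; fin_cases i <;> simp [h0, h1]
      have h4 : fderiv ℂ (mon a b) 0 v = 0 := by
        rw [h3, map_smul, fderiv_mon_single, smul_zero]
      have h5 : α 0 * v 2 = 0 := by
        simp [hL, h4, dz] at h2
        linear_combination h2
      have h6 : v 2 = 0 := (mul_eq_zero.1 h5).resolve_left hα0
      rw [h3, h6, zero_smul]
    refine ⟨(LinearEquiv.ofInjectiveEndo (L : C3 →ₗ[ℂ] C3) hinj).toContinuousLinearEquiv, ?_⟩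
    ext v
    rfl

theorem pullback_fiberMap {a b d k : ℕ} {h α β : ℂ → ℂ} {P : C3}
    (hα : AnalyticAt ℂ α (mon a b P)) (hβ : AnalyticAt ℂ β (mon a b P)) (v : C3) :
    pullback (fiberMap a b α β) (cuspForm a b d k h) P v =
      (2 * (α (mon a b P) * P 2 + β (mon a b P)) + mon a b P ^ k * h (mon a b P)) *
        (α (mon a b P) * v 2 + (deriv α (mon a b P) * P 2 + deriv β (mon a b P)) *
          fderiv ℂ (mon a b) P v) +
      d * mon a b P ^ (d - 1) * fderiv ℂ (mon a b) P v := by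
  have hΦ := hasFDerivAt_fiberMap hα hβ
  have hmon : fderiv ℂ (mon a b) (fiberMap a b α β P) (fderiv ℂ (fiberMap a b α β) P v) =
      fderiv ℂ (mon a b) P v := by
    have h1 := (hasFDerivAt_mon a b (fiberMap a b α β P)).comp P hΦ
    have h2 : mon a b ∘ fiberMap a b α β = mon a b := funext (mon_fiberMap a b α β)
    rw [h2] at h1
    rw [hΦ.fderiv]
    exact (congrArg (fun L : C3 →L[ℂ] ℂ => L v) ((hasFDerivAt_mon a b P).unique h1)).symm
  simp only [pullback, ContinuousLinearMap.comp_apply, cuspForm_apply, hmon, mon_fiberMap,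
    fiberMap_two]
  have h3 : fderiv ℂ (fiberMap a b α β) P v 2 = α (mon a b P) * v 2 +
      (deriv α (mon a b P) * P 2 + deriv β (mon a b P)) * fderiv ℂ (mon a b) P v := by
    rw [hΦ.fderiv]
    simp [dz]
    ring
  rw [h3]

/-- The two graphs `z = u β₁ ± i α u ^ (r / 2)` are invariant. The equation of an invariant graph
is split into its parts that are even and odd under the exchange of the two signs, and the odd part
is divided by `i u ^ (r / 2)`, so that odd `r` is covered as well. -/
structure IsSplitting (d k r : ℕ) (h α β₁ : ℂ → ℂ) : Prop where
  analytic_α : AnalyticAt ℂ α 0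
  analytic_β₁ : AnalyticAt ℂ β₁ 0
  α_ne_zero : α 0 ≠ 0
  even_part : ∀ᶠ u in 𝓝 (0 : ℂ), deriv (fun u => u * β₁ u) u * (2 * (u * β₁ u) + u ^ k * h u) +
    d * u ^ (d - 1) = r * u ^ (r - 1) * α u ^ 2 + 2 * u ^ r * α u * deriv α u
  odd_part : ∀ᶠ u in 𝓝 (0 : ℂ), u * deriv α u * (2 * β₁ u + u ^ (k - 1) * h u) +
    2 * α u * deriv (fun u => u * β₁ u) u + r * α u * (2 * β₁ u + u ^ (k - 1) * h u) / 2 = 0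

/-- The equation `(z - u β₁) ^ 2 + α ^ 2 u ^ r` of the union of the graphs
`z = u β₁ ± i α u ^ (r / 2)`. -/
def sepEquation (a b r : ℕ) (α β₁ : ℂ → ℂ) (P : C3) : ℂ :=
  (P 2 - mon a b P * β₁ (mon a b P)) ^ 2 + α (mon a b P) ^ 2 * mon a b P ^ r

namespace IsSplitting

variable {a b d k r : ℕ} {h α β₁ : ℂ → ℂ}

theorem foliationEquiv (hab : 1 ≤ a + b) (hk : 1 ≤ k) (hr : 1 ≤ r) (hh : AnalyticAt ℂ h 0)
    (hs : IsSplitting d k r h α β₁) : ∃ g : ℂ × ℂ → ℂ, AnalyticAt ℂ g 0 ∧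
      FoliationEquiv (cuspForm a b d k h) (normalForm a b r g) := by
  have hα := hs.analytic_α
  have hβ₁ := hs.analytic_β₁
  have hr0 : (r : ℂ) ≠ 0 := by exact_mod_cast (by omega : r ≠ 0)
  set A : ℂ → ℂ := fun u => α u ^ 2 + 2 * u * α u * deriv α u / r with hA
  have hAa : AnalyticAt ℂ A 0 := by
    have := hα.deriv
    exact (hα.pow 2).add ((((analyticAt_const.mul analyticAt_id).mul hα).mul this).div_const)
  have hA0 : A 0 ≠ 0 := by simpa [hA] using hs.α_ne_zero
  set n₁ : ℂ → ℂ := fun u => 2 * β₁ u + u ^ (k - 1) * h u with hn₁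
  have hn₁a : AnalyticAt ℂ n₁ 0 :=
    (analyticAt_const.mul hβ₁).add ((analyticAt_id.pow _).mul hh)
  have hβ : AnalyticAt ℂ (fun u => u * β₁ u) 0 := analyticAt_id.mul hβ₁
  have hfst : ∀ {f : ℂ → ℂ}, AnalyticAt ℂ f 0 → AnalyticAt ℂ (fun p : ℂ × ℂ => f p.1) 0 :=
    fun hf => AnalyticAt.fun_comp (by exact hf) analyticAt_fst
  -- With `F = z ^ 2 + u ^ r` and `u n₁ = 2 u β₁ + u ^ k h`, the pull-back of the form is
  -- `A dF + (α n₁ / 2 - 2 α α' z / r) (2 u dz - r z du)`.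
  refine ⟨fun p => (α p.1 * n₁ p.1 / 2 - 2 * α p.1 * deriv α p.1 / r * p.2) / A p.1, ?_,
    fiberMap a b α (fun u => u * β₁ u), fun P => A (mon a b P), ?_, ?_, ?_, ?_⟩
  · refine AnalyticAt.fun_div ?_ (hfst hAa) hA0
    exact (((hfst hα).mul (hfst hn₁a)).div_const).sub
      ((((analyticAt_const.mul (hfst hα)).mul (hfst hα.deriv)).div_const).mul analyticAt_snd)
  · exact isBiholomorphicGerm_fiberMap hab hα hβ hs.α_ne_zero (by simp)
  · exact analyticAt_comp_mon hab hAa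
  · simpa [mon_zero hab] using hA0
  have hm := tendsto_mon hab
  filter_upwards [hm.eventually hα.eventually_analyticAt, hm.eventually hβ.eventually_analyticAt,
    hm.eventually (hAa.continuousAt.eventually_ne hA0), hm.eventually hs.even_part,
    hm.eventually hs.odd_part] with P a1 a2 hAP e1 e2
  ext v
  rw [pullback_fiberMap a1 a2]
  simp only [normalForm, fderiv_surf, _root_.add_apply, _root_.sub_apply, _root_.smul_apply,
    smul_eq_mul]
  simp only [dz, ContinuousLinearMap.proj_apply]
  generalize hu : mon a b P = u at *
  generalize fderiv ℂ (mon a b) P v = w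
  generalize deriv (fun u => u * β₁ u) u = β' at *
  have hAu : A u = α u ^ 2 + 2 * u * α u * deriv α u / r := rfl
  have hnu : n₁ u = 2 * β₁ u + u ^ (k - 1) * h u := rfl
  have hku : u ^ k = u * u ^ (k - 1) := by rw [← pow_succ']; congr 1; omega
  have hru : u ^ r = u * u ^ (r - 1) := by rw [← pow_succ']; congr 1; omega
  have hN : 2 * (u * β₁ u) + u ^ k * h u = u * n₁ u := by rw [hku, hnu]; ring
  rw [← hnu] at e2
  rw [hN] at e1
  have hN' : 2 * (α u * P 2 + u * β₁ u) + u ^ k * h u = 2 * α u * P 2 + u * n₁ u := by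
    rw [← hN]; ring
  rw [hN']
  have hrhs : A u * (2 * P 2 * v 2 + r * u ^ (r - 1) * w +
      (α u * n₁ u / 2 - 2 * α u * deriv α u / r * P 2) / A u * (2 * u * v 2 - r * P 2 * w)) =
      A u * (2 * P 2 * v 2 + r * u ^ (r - 1) * w) +
      (α u * n₁ u / 2 - 2 * α u * deriv α u / r * P 2) * (2 * u * v 2 - r * P 2 * w) := by
    field_simp
  rw [hrhs, hAu]
  rw [hru] at e1
  field_simp
  linear_combination 2 * r * w * e1 + 2 * r * w * P 2 * e2

theorem isInvariantEquation (hab : 1 ≤ a + b) (hk : 1 ≤ k) (hr : 1 ≤ r)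
    (hs : IsSplitting d k r h α β₁) :
    IsInvariantEquation (cuspForm a b d k h) (sepEquation a b r α β₁) := by
  have hα := hs.analytic_α
  have hβ : AnalyticAt ℂ (fun u => u * β₁ u) 0 := analyticAt_id.mul hs.analytic_β₁
  have hm := tendsto_mon hab
  refine ⟨?_, ?_, ?_, ?_⟩
  · exact (((analyticAt_coord 2 0).sub (analyticAt_comp_mon hab hβ)).pow 2).add
      (((analyticAt_comp_mon hab hα).pow 2).mul ((analyticAt_mon a b 0).pow r))
  · simp [sepEquation, mon_zero hab, show r ≠ 0 by omega]
  · intro hc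
    have h1 : Tendsto (fun s : ℂ => s • (Pi.single 2 1 : C3)) (𝓝[≠] 0) (𝓝 0) := by
      have : Continuous (fun s : ℂ => s • (Pi.single 2 1 : C3)) := by fun_prop
      exact (this.tendsto' 0 0 (by simp)).mono_left nhdsWithin_le_nhds
    obtain ⟨s, hs, hs0⟩ := ((h1.eventually hc).and self_mem_nhdsWithin).exists
    have hs0' : s ≠ 0 := hs0
    have h2 : mon a b (s • (Pi.single 2 1 : C3)) = 0 := by
      have := mon_add_single a b 0 s
      rwa [zero_add, mon_zero hab] at this
    simp [sepEquation, h2, hs0', show r ≠ 0 by omega] at hs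
  · intro v w
    refine ⟨fun P => 4 * deriv (fun u => u * β₁ u) (mon a b P) *
      (w 2 * fderiv ℂ (mon a b) P v - v 2 * fderiv ℂ (mon a b) P w), ?_, ?_⟩
    · exact (analyticAt_const.mul (analyticAt_comp_mon hab hβ.deriv)).mul
        ((analyticAt_const.mul (analyticAt_fderiv_apply (analyticAt_mon a b 0) v)).sub
          (analyticAt_const.mul (analyticAt_fderiv_apply (analyticAt_mon a b 0) w)))
    filter_upwards [hm.eventually hα.eventually_analyticAt, hm.eventually hβ.eventually_analyticAt,
      hm.eventually hs.even_part, hm.eventually hs.odd_part] with P a1 a2 e1 e2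
    have hf : ∀ x, fderiv ℂ (sepEquation a b r α β₁) P x =
        2 * (P 2 - mon a b P * β₁ (mon a b P)) *
          (x 2 - deriv (fun u => u * β₁ u) (mon a b P) * fderiv ℂ (mon a b) P x) +
        (r * mon a b P ^ (r - 1) * α (mon a b P) ^ 2 +
          2 * mon a b P ^ r * α (mon a b P) * deriv α (mon a b P)) * fderiv ℂ (mon a b) P x := by
      intro x
      have h1 := a1.differentiableAt.hasDerivAt.comp_hasFDerivAt P (hasFDerivAt_mon a b P)
      have h2 := ((hasFDerivAt_graph a2).pow 2).add
        ((h1.pow 2).mul ((hasFDerivAt_mon a b P).pow r))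
      have h3 : fderiv ℂ (sepEquation a b r α β₁) P x = _ :=
        congrArg (fun L : C3 →L[ℂ] ℂ => L x) h2.fderiv
      rw [h3]
      simp [dz]
      ring
    rw [hf, hf, cuspForm_apply, cuspForm_apply]
    simp only [sepEquation]
    generalize hu : mon a b P = u at *
    generalize fderiv ℂ (mon a b) P v = V
    generalize fderiv ℂ (mon a b) P w = W
    generalize deriv (fun u => u * β₁ u) u = β' at *
    have hku : u ^ k = u * u ^ (k - 1) := by rw [← pow_succ']; congr 1; omega
    have hru : u ^ r = u * u ^ (r - 1) := by rw [← pow_succ']; congr 1; omega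
    rw [hku] at e1 ⊢
    rw [hru] at e1 ⊢
    linear_combination (2 * (P 2 - u * β₁ u) * (V * w 2 - W * v 2)) * e1 -
      2 * u * u ^ (r - 1) * α u * (V * w 2 - W * v 2) * e2

theorem setGermEquiv (hab : 1 ≤ a + b) (hs : IsSplitting d k r h α β₁) :
    SetGermEquiv {P | sepEquation a b r α β₁ P = 0} {P | surf a b r P = 0} := by
  have hα := hs.analytic_α
  have hβ : AnalyticAt ℂ (fun u => u * β₁ u) 0 := analyticAt_id.mul hs.analytic_β₁
  refine ⟨_, isBiholomorphicGerm_fiberMap hab hα hβ hs.α_ne_zero (by simp), ?_⟩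
  filter_upwards [(tendsto_mon hab).eventually (hα.continuousAt.eventually_ne hs.α_ne_zero)]
    with P hP
  simp only [sepEquation, mon_fiberMap, fiberMap_two, surf]
  have : (α (mon a b P) * P 2 + mon a b P * β₁ (mon a b P) - mon a b P * β₁ (mon a b P)) ^ 2 +
      α (mon a b P) ^ 2 * mon a b P ^ r = α (mon a b P) ^ 2 * (P 2 ^ 2 + mon a b P ^ r) := by ring
  rw [this, mul_eq_zero, or_iff_right (pow_ne_zero 2 hP)]

end IsSplitting

/-! ### Invariant graphs -/

theorem eventually_of_eventually_pow {M : ℕ} (hM : 1 ≤ M) {p : ℂ → Prop}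
    (h : ∀ᶠ w in 𝓝 (0 : ℂ), p (w ^ M)) : ∀ᶠ u in 𝓝 (0 : ℂ), p u := by
  obtain ⟨ε, hε, hb⟩ := Metric.eventually_nhds_iff_ball.1 h
  filter_upwards [Metric.ball_mem_nhds (0 : ℂ) (pow_pos hε M)] with u hu
  obtain ⟨w, rfl⟩ := IsAlgClosed.exists_pow_nat_eq u (n := M) hM
  refine hb w ?_
  rw [mem_ball_zero_iff, norm_pow] at hu
  rw [mem_ball_zero_iff]
  exact lt_of_pow_lt_pow_left₀ M hε.le hu

theorem eventually_zero_of_pow_mul {M n : ℕ} (hM : 1 ≤ M) {Φ : ℂ → ℂ} (hΦ : AnalyticAt ℂ Φ 0)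
    (h : ∀ᶠ w in 𝓝 (0 : ℂ), w ^ n * Φ (w ^ M) = 0) : ∀ᶠ u in 𝓝 (0 : ℂ), Φ u = 0 := by
  have h1 : AnalyticAt ℂ (fun w : ℂ => Φ (w ^ M)) 0 :=
    AnalyticAt.fun_comp (by simpa [show M ≠ 0 by omega] using hΦ) (analyticAt_id.pow M)
  refine eventually_of_eventually_pow hM
    (eventually_eq_zero_of_mul (analyticAt_id.pow n) h1 h fun hc => ?_)
  obtain ⟨s, hs, hs0⟩ := ((hc.filter_mono (nhdsWithin_le_nhds (s := {0}ᶜ))).and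
    self_mem_nhdsWithin).exists
  exact pow_ne_zero n hs0 hs

theorem hasDerivAt_pow_mul {t : ℂ → ℂ} {u : ℂ} {e : ℕ} (ht : AnalyticAt ℂ t u) :
    HasDerivAt (fun u => u ^ e * t u) (e * u ^ (e - 1) * t u + u ^ e * deriv t u) u :=
  (hasDerivAt_pow e u).fun_mul ht.differentiableAt.hasDerivAt

theorem isSolution_of_reduced {d k e : ℕ} {h t : ℂ → ℂ} (he : 1 ≤ e) (hed : 2 * e ≤ d)
    (hek : e ≤ k) (ht : AnalyticAt ℂ t 0)
    (hs : ∀ᶠ u in 𝓝 (0 : ℂ), (2 * t u + u ^ (k - e) * h u) * (u * deriv t u + e * t u) +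
      d * u ^ (d - 2 * e) = 0) : IsSolution d k h fun u => u ^ e * t u := by
  filter_upwards [hs, ht.eventually_analyticAt] with u e1 a1
  rw [(hasDerivAt_pow_mul a1).deriv]
  have h1 : u ^ k = u ^ e * u ^ (k - e) := by rw [← pow_add]; congr 1; omega
  have h2 : u ^ e = u * u ^ (e - 1) := by rw [← pow_succ']; congr 1; omega
  have h3 : u ^ (d - 1) = u * u ^ (e - 1) * u ^ (e - 1) * u ^ (d - 2 * e) := by
    rw [mul_assoc u, ← pow_add, ← pow_succ', ← pow_add]; congr 1; omega
  rw [h1, h3, h2]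
  linear_combination u * u ^ (e - 1) * u ^ (e - 1) * e1

/-- Existence of an invariant graph `z = u ^ e * t(u)` with prescribed `t 0 = t₀`. The number `l` is
the value at the origin of `2 t + u ^ (k - e) h`. -/
theorem exists_solution {d k e : ℕ} {h : ℂ → ℂ} (he : 1 ≤ e) (hed : 2 * e ≤ d)
    (hek : e ≤ k) (hh : AnalyticAt ℂ h 0) {t₀ l : ℂ} (hl : 2 * t₀ + 0 ^ (k - e) * h 0 = l)
    (h0 : l * (e * t₀) + d * 0 ^ (d - 2 * e) = 0) (hne : l ≠ 0)
    (hres : ∀ n : ℕ, 1 ≤ n → 2 * e * t₀ + l * (e + n) ≠ 0) :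
    ∃ t : ℂ → ℂ, AnalyticAt ℂ t 0 ∧ t 0 = t₀ ∧ IsSolution d k h fun u => u ^ e * t u := by
  subst hl
  obtain ⟨t, ht, ht0, hs⟩ := exists_analytic_solution (G := fun u => u ^ (k - e) * h u)
    (E := fun u => d * u ^ (d - 2 * e)) ((analyticAt_id.pow _).mul hh)
    (analyticAt_const.mul (analyticAt_id.pow _)) h0 hne hres
  exact ⟨t, ht, ht0, isSolution_of_reduced he hed hek ht hs⟩

/-- If `ρ = t₁ / t₂`, then `t₁ t₂ = 1` gives `h₀ ^ 2 = 4 (ρ + 1) ^ 2 / ρ`, and this is the excluded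
value `(16 + s) ^ 2 / (16 + 2 s)` for `s = 8 (ρ - 1)`. So `ρ` is not a positive rational number; by
symmetry only `ρ ≥ 1` has to be considered. -/
theorem not_resonant {h₀ t₁ t₂ : ℂ}
    (hP : ∀ s : ℚ, 0 ≤ s → h₀ ^ 2 ≠ (16 + (s : ℂ)) ^ 2 / (16 + 2 * (s : ℂ)))
    (hprod : t₁ * t₂ = 1) (hsum : t₁ + t₂ = -h₀ / 2) {m n : ℕ} (hm : 1 ≤ m) (hn : 1 ≤ n) :
    m * t₂ ≠ n * t₁ := by
  intro heq
  wlog hmn : n ≤ m generalizing t₁ t₂ m n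
  · exact this (t₁ := t₂) (t₂ := t₁) (by rw [mul_comm, hprod]) (by rw [add_comm, hsum]) hn hm
      heq.symm (by omega)
  have hm0 : (m : ℂ) ≠ 0 := by exact_mod_cast (by omega : m ≠ 0)
  have hn0 : (n : ℂ) ≠ 0 := by exact_mod_cast (by omega : n ≠ 0)
  refine hP (8 * ((m : ℚ) - n) / n) ?_ ?_
  · have : (n : ℚ) ≤ m := by exact_mod_cast hmn
    have : (0 : ℚ) ≤ m - n := by linarith
    positivity
  · push_cast
    have h1 : (n : ℂ) * t₁ ^ 2 = m := by linear_combination -t₁ * heq + m * hprod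
    have h2 : (m : ℂ) * t₂ ^ 2 = n := by linear_combination t₂ * heq + n * hprod
    have h3 : h₀ ^ 2 = 4 * (t₁ + t₂) ^ 2 := by rw [hsum]; ring
    have h4 : (16 : ℂ) + 2 * (8 * (m - n) / n) = 16 * m / n := by field_simp; ring
    have h5 : (16 : ℂ) + 8 * (m - n) / n = 8 * (m + n) / n := by field_simp; ring
    rw [h3, h4, h5]
    field_simp
    linear_combination (64 * m) * h1 + (64 * n) * h2 + (128 * m * n) * hprod

/-! ### Two invariant graphs over the base -/

theorem analyticAt_deriv_mul {β₁ : ℂ → ℂ} (hβ₁ : AnalyticAt ℂ β₁ 0) :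
    AnalyticAt ℂ (deriv fun u => u * β₁ u) 0 := (analyticAt_id.mul hβ₁).deriv

theorem analyticAt_oddPart {k r : ℕ} {h α β₁ : ℂ → ℂ} (hh : AnalyticAt ℂ h 0)
    (hα : AnalyticAt ℂ α 0) (hβ₁ : AnalyticAt ℂ β₁ 0) :
    AnalyticAt ℂ (fun u => u * deriv α u * (2 * β₁ u + u ^ (k - 1) * h u) +
      2 * α u * deriv (fun u => u * β₁ u) u +
      r * α u * (2 * β₁ u + u ^ (k - 1) * h u) / 2) 0 := by
  have h1 : AnalyticAt ℂ (fun u => 2 * β₁ u + u ^ (k - 1) * h u) 0 :=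
    (analyticAt_const.mul hβ₁).add ((analyticAt_id.pow _).mul hh)
  exact (((analyticAt_id.mul hα.deriv).mul h1).add ((analyticAt_const.mul hα).mul
    (analyticAt_deriv_mul hβ₁))).add (((analyticAt_const.mul hα).mul h1).div_const)

/-- Two invariant graphs with distinct leading coefficients give a splitting, by the half sum and
the half difference of their equations. -/
theorem isSplitting_of_solutions {d k e : ℕ} {h t₁ t₂ : ℂ → ℂ} (he : 1 ≤ e) (hk : 1 ≤ k)
    (hh : AnalyticAt ℂ h 0) (ht₁ : AnalyticAt ℂ t₁ 0) (ht₂ : AnalyticAt ℂ t₂ 0)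
    (h12 : t₁ 0 ≠ t₂ 0)
    (hs₁ : IsSolution d k h fun u => u ^ e * t₁ u) (hs₂ : IsSolution d k h fun u => u ^ e * t₂ u) :
    IsSplitting d k (2 * e) h (fun u => (t₁ u - t₂ u) / (2 * Complex.I))
      (fun u => u ^ (e - 1) * ((t₁ u + t₂ u) / 2)) := by
  have hα : AnalyticAt ℂ (fun u => (t₁ u - t₂ u) / (2 * Complex.I)) 0 := (ht₁.sub ht₂).div_const
  have hβ₁ : AnalyticAt ℂ (fun u => u ^ (e - 1) * ((t₁ u + t₂ u) / 2)) 0 :=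
    (analyticAt_id.pow _).mul ((ht₁.add ht₂).div_const)
  have hI := Complex.I_ne_zero
  have hpow : ∀ u : ℂ, u ^ e = u * u ^ (e - 1) := fun u => by rw [← pow_succ']; congr 1; omega
  have hpow2 : ∀ u : ℂ, u ^ (2 * e - 1) = u * u ^ (e - 1) * u ^ (e - 1) := fun u => by
    rw [mul_assoc, ← pow_add, ← pow_succ']; congr 1; omega
  have hpow2' : ∀ u : ℂ, u ^ (2 * e) = u * u * u ^ (e - 1) * u ^ (e - 1) := fun u => by
    rw [mul_comm 2 e, pow_mul, hpow]; ring
  have hpowk : ∀ u : ℂ, u ^ k = u * u ^ (k - 1) := fun u => by rw [← pow_succ']; congr 1; omega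
  have hdβ : ∀ᶠ u in 𝓝 (0 : ℂ), deriv (fun u => u * (u ^ (e - 1) * ((t₁ u + t₂ u) / 2))) u =
      e * u ^ (e - 1) * ((t₁ u + t₂ u) / 2) +
        u * u ^ (e - 1) * ((deriv t₁ u + deriv t₂ u) / 2) := by
    filter_upwards [ht₁.eventually_analyticAt, ht₂.eventually_analyticAt] with u a1 a2
    have h1 : (fun u : ℂ => u * (u ^ (e - 1) * ((t₁ u + t₂ u) / 2))) =
        fun u => u ^ e * ((t₁ u + t₂ u) / 2) := by
      funext u; rw [hpow]; ring
    rw [h1, (hasDerivAt_pow_mul (t := fun u => (t₁ u + t₂ u) / 2) ((a1.add a2).div_const)).deriv,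
      ((a1.differentiableAt.hasDerivAt.fun_add a2.differentiableAt.hasDerivAt).div_const 2).deriv,
      ← hpow]
  have hdα : ∀ᶠ u in 𝓝 (0 : ℂ), deriv (fun u => (t₁ u - t₂ u) / (2 * Complex.I)) u =
      (deriv t₁ u - deriv t₂ u) / (2 * Complex.I) := by
    filter_upwards [ht₁.eventually_analyticAt, ht₂.eventually_analyticAt] with u a1 a2
    exact ((a1.differentiableAt.hasDerivAt.fun_sub
      a2.differentiableAt.hasDerivAt).div_const _).deriv
  have hsol : ∀ᶠ u in 𝓝 (0 : ℂ),
      ((2 * (u * u ^ (e - 1) * t₁ u) + u * u ^ (k - 1) * h u) *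
        (e * u ^ (e - 1) * t₁ u + u * u ^ (e - 1) * deriv t₁ u) + d * u ^ (d - 1) = 0) ∧
      ((2 * (u * u ^ (e - 1) * t₂ u) + u * u ^ (k - 1) * h u) *
        (e * u ^ (e - 1) * t₂ u + u * u ^ (e - 1) * deriv t₂ u) + d * u ^ (d - 1) = 0) := by
    filter_upwards [hs₁, hs₂, ht₁.eventually_analyticAt, ht₂.eventually_analyticAt]
      with u e1 e2 a1 a2
    rw [(hasDerivAt_pow_mul a1).deriv, hpow, hpowk] at e1
    rw [(hasDerivAt_pow_mul a2).deriv, hpow, hpowk] at e2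
    exact ⟨e1, e2⟩
  refine ⟨hα, hβ₁, div_ne_zero (sub_ne_zero.2 h12) (by simp), ?_, ?_⟩
  · filter_upwards [hdβ, hdα, hsol] with u e1 e2 e3
    rw [e1, e2, hpow2, hpow2', hpowk]
    have hα2 : ((t₁ u - t₂ u) / (2 * Complex.I)) ^ 2 = -(t₁ u - t₂ u) ^ 2 / 4 := by
      rw [div_pow, mul_pow, Complex.I_sq]; ring
    have hαα : (t₁ u - t₂ u) / (2 * Complex.I) * ((deriv t₁ u - deriv t₂ u) / (2 * Complex.I)) =
        -(t₁ u - t₂ u) * (deriv t₁ u - deriv t₂ u) / 4 := by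
      rw [div_mul_div_comm, mul_mul_mul_comm, Complex.I_mul_I]; ring
    push_cast
    linear_combination (e3.1 + e3.2) / 2 - 2 * e * (u * u ^ (e - 1) * u ^ (e - 1)) * hα2 -
      2 * (u * u * u ^ (e - 1) * u ^ (e - 1)) * hαα
  · refine eventually_zero_of_pow_mul (M := 1) (n := e) le_rfl
      (analyticAt_oddPart hh hα hβ₁) ?_
    filter_upwards [hdβ, hdα, hsol] with u e1 e2 e3
    rw [pow_one, e1, e2, hpow]
    push_cast
    field_simp
    linear_combination e3.1 - e3.2

/-- The conclusion of the theorem, for the exponent `r` and the separatrix determined by a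
splitting. -/
theorem IsSplitting.conclusion {a b d k r : ℕ} {h α β₁ : ℂ → ℂ} (hab : 1 ≤ a + b) (hk : 1 ≤ k)
    (hr : 1 ≤ r) (hh : AnalyticAt ℂ h 0) (hs : IsSplitting d k r h α β₁)
    (hsep : ∀ f : C3 → ℂ, IsInvariantEquation (cuspForm a b d k h) f →
      ∀ᶠ P in 𝓝 (0 : C3), f P = 0 → sepEquation a b r α β₁ P = 0) :
    (∃ g : ℂ × ℂ → ℂ, AnalyticAt ℂ g 0 ∧
      FoliationEquiv (cuspForm a b d k h) (normalForm a b r g)) ∧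
    (∃ V : Set C3, IsSeparatrix (cuspForm a b d k h) V ∧
      SetGermEquiv V {P | surf a b r P = 0}) :=
  ⟨hs.foliationEquiv hab hk hr hh, {P | sepEquation a b r α β₁ P = 0},
    ⟨⟨_, hs.isInvariantEquation hab hk hr, Eventually.of_forall fun _ => Iff.rfl⟩, hsep⟩,
    hs.setGermEquiv hab⟩

theorem conclusion_of_solutions {a b d k e : ℕ} {h t₁ t₂ : ℂ → ℂ} (hab : 1 ≤ a + b) (hk : 1 ≤ k)
    (he : 1 ≤ e) (hek : e ≤ k) (hh : AnalyticAt ℂ h 0) (ht₁ : AnalyticAt ℂ t₁ 0)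
    (ht₂ : AnalyticAt ℂ t₂ 0)
    (hs₁ : IsSolution d k h fun u => u ^ e * t₁ u) (hs₂ : IsSolution d k h fun u => u ^ e * t₂ u)
    (hres : ∀ m n : ℕ, 1 ≤ m → 1 ≤ n →
      m * (2 * t₁ 0 + 0 ^ (k - e) * h 0) ≠ n * (2 * t₂ 0 + 0 ^ (k - e) * h 0)) :
    (∃ g : ℂ × ℂ → ℂ, AnalyticAt ℂ g 0 ∧
      FoliationEquiv (cuspForm a b d k h) (normalForm a b (2 * e) g)) ∧
    (∃ V : Set C3, IsSeparatrix (cuspForm a b d k h) V ∧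
      SetGermEquiv V {P | surf a b (2 * e) P = 0}) := by
  have h12 : t₁ 0 ≠ t₂ 0 := fun hc => hres 1 1 le_rfl le_rfl (by rw [hc])
  refine (isSplitting_of_solutions he hk hh ht₁ ht₂ h12 hs₁ hs₂).conclusion hab hk (by omega) hh ?_
  intro f hf
  have hG : AnalyticAt ℂ (fun u => u ^ (k - e) * h u) 0 := (analyticAt_id.pow _).mul hh
  filter_upwards [zero_mem_graphs hab he hh hG (Eventually.of_forall fun u => by
    rw [← mul_assoc, ← pow_add]; congr 2; omega) ht₁ ht₂ hs₁ hs₂ hres hf.1 hf.2.2.1 hf.2.2.2]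
    with P hP h0
  rw [← hP h0, sepEquation, ← mul_assoc, ← pow_succ', Nat.sub_add_cancel he, div_pow, mul_pow,
    Complex.I_sq]
  ring

/-! ### The double cover -/

/-- The map `(x, y, z) ↦ (x ^ 2, y ^ 2, z)`. -/
def doubleCover (P : C3) : C3 := ![P 0 ^ 2, P 1 ^ 2, P 2]

theorem mon_doubleCover (a b : ℕ) (P : C3) : mon a b (doubleCover P) = mon a b P ^ 2 := by
  simp [mon, doubleCover]; ring

theorem hasFDerivAt_doubleCover (P : C3) : HasFDerivAt doubleCover
    (ContinuousLinearMap.pi ![(2 * P 0) • (ContinuousLinearMap.proj 0 : C3 →L[ℂ] ℂ),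
      (2 * P 1) • (ContinuousLinearMap.proj 1 : C3 →L[ℂ] ℂ),
      (ContinuousLinearMap.proj 2 : C3 →L[ℂ] ℂ)]) P := by
  rw [hasFDerivAt_pi']
  have hc : ∀ i : Fin 3, HasFDerivAt (fun Q : C3 => Q i)
    (ContinuousLinearMap.proj (R := ℂ) (φ := fun _ : Fin 3 => ℂ) i) P := fun i =>
    (ContinuousLinearMap.proj (R := ℂ) (φ := fun _ : Fin 3 => ℂ) i).hasFDerivAt
  intro i
  fin_cases i
  · refine ((hc 0).pow 2).congr_fderiv ?_
    ext v; simp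
  · refine ((hc 1).pow 2).congr_fderiv ?_
    ext v; simp
  · exact hc 2

theorem analyticAt_doubleCover : AnalyticAt ℂ doubleCover 0 := by
  rw [analyticAt_pi_iff]
  intro i
  fin_cases i
  · exact (analyticAt_coord 0 0).pow 2
  · exact (analyticAt_coord 1 0).pow 2
  · exact analyticAt_coord 2 0

theorem doubleCover_zero : doubleCover 0 = 0 := by
  ext i; fin_cases i <;> simp [doubleCover]

theorem eventually_of_doubleCover {p : C3 → Prop} (h : ∀ᶠ P in 𝓝 (0 : C3), p (doubleCover P)) :
    ∀ᶠ P in 𝓝 (0 : C3), p P := by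
  obtain ⟨ε, hε, hb⟩ := Metric.eventually_nhds_iff_ball.1 h
  have hδ : 0 < min ε (ε ^ 2) := by positivity
  filter_upwards [Metric.ball_mem_nhds (0 : C3) hδ] with P hP
  rw [mem_ball_zero_iff, pi_norm_lt_iff hδ] at hP
  obtain ⟨x, hx⟩ := IsAlgClosed.exists_pow_nat_eq (P 0) (n := 2) (by norm_num)
  obtain ⟨y, hy⟩ := IsAlgClosed.exists_pow_nat_eq (P 1) (n := 2) (by norm_num)
  have hsq : ∀ {w : ℂ} {i : Fin 3}, w ^ 2 = P i → ‖w‖ < ε := fun {w i} hw => by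
    have h1 := (hP i).trans_le (min_le_right _ _)
    rw [← hw, norm_pow] at h1
    exact lt_of_pow_lt_pow_left₀ 2 hε.le h1
  have h2 : doubleCover ![x, y, P 2] = P := by
    ext i; fin_cases i <;> simp [doubleCover, hx, hy]
  rw [← h2]
  refine hb _ ?_
  rw [mem_ball_zero_iff, pi_norm_lt_iff hε]
  intro i
  fin_cases i
  · exact hsq hx
  · exact hsq hy
  · exact (hP 2).trans_le (min_le_left _ _)

/-- The pull-back of the form by the double cover is a form of the same kind. -/
theorem cuspForm_doubleCover (a b d k : ℕ) (hd : 1 ≤ d) (h : ℂ → ℂ) (P v : C3) :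
    cuspForm a b (2 * d) (2 * k) (fun w => h (w ^ 2)) P v =
      cuspForm a b d k h (doubleCover P) (fderiv ℂ doubleCover P v) := by
  have hκ := hasFDerivAt_doubleCover P
  have h1 : fderiv ℂ (mon a b) (doubleCover P) (fderiv ℂ doubleCover P v) =
      2 * mon a b P * fderiv ℂ (mon a b) P v := by
    have h2 := (hasFDerivAt_mon a b (doubleCover P)).comp P hκ.differentiableAt.hasFDerivAt
    have h3 : mon a b ∘ doubleCover = fun Q => mon a b Q ^ 2 := funext (mon_doubleCover a b)
    rw [h3] at h2
    have h4 := congrArg (fun L : C3 →L[ℂ] ℂ => L v) (((hasFDerivAt_mon a b P).pow 2).unique h2)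
    simpa using h4.symm
  have h5 : fderiv ℂ doubleCover P v 2 = v 2 := by rw [hκ.fderiv]; simp
  rw [cuspForm_apply, cuspForm_apply, h1, h5, mon_doubleCover]
  have h6 : doubleCover P 2 = P 2 := rfl
  have h7 : mon a b P ^ (2 * d - 1) = mon a b P * (mon a b P ^ 2) ^ (d - 1) := by
    rw [← pow_mul, ← pow_succ']; congr 1; omega
  rw [h6, h7, pow_mul]
  push_cast
  ring

/-- The cofactors may be chosen bilinear in the two vectors. -/
theorem DividesWedge.exists_coordinate_cofactors {ω : OneForm} {f : C3 → ℂ}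
    (hf : DividesWedge ω f) : ∃ c : Fin 3 → Fin 3 → C3 → ℂ, (∀ i j, AnalyticAt ℂ (c i j) 0) ∧
      ∀ᶠ P in 𝓝 (0 : C3), ∀ v w : C3, ω P v * fderiv ℂ f P w - ω P w * fderiv ℂ f P v =
        f P * ∑ i, ∑ j, v i * w j * c i j P := by
  choose c hc hcf using fun i j : Fin 3 => hf (Pi.single i 1) (Pi.single j 1)
  refine ⟨c, hc, ?_⟩
  have hall : ∀ᶠ P in 𝓝 (0 : C3), ∀ i j : Fin 3,
      ω P (Pi.single i 1) * fderiv ℂ f P (Pi.single j 1) -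
        ω P (Pi.single j 1) * fderiv ℂ f P (Pi.single i 1) = f P * c i j P :=
    eventually_all.2 fun i => eventually_all.2 fun j => hcf i j
  filter_upwards [hall] with P hP v w
  have hexp : ∀ (L : C3 →L[ℂ] ℂ) (x : C3), L x = ∑ i, x i * L (Pi.single i 1) := by
    intro L x
    conv_lhs => rw [← Finset.univ_sum_single x, map_sum]
    refine Finset.sum_congr rfl fun i _ => ?_
    have : Pi.single i (x i) = x i • (Pi.single i 1 : C3) := by
      rw [← Pi.single_smul, smul_eq_mul, mul_one]
    rw [this, map_smul, smul_eq_mul]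
  rw [hexp (ω P) v, hexp (ω P) w, hexp (fderiv ℂ f P) v, hexp (fderiv ℂ f P) w,
    Finset.sum_mul_sum, Finset.sum_mul_sum, Finset.sum_comm (f := fun i j : Fin 3 =>
      w i * ω P (Pi.single i 1) * (v j * fderiv ℂ f P (Pi.single j 1))), ← Finset.sum_sub_distrib,
    Finset.mul_sum]
  refine Finset.sum_congr rfl fun i _ => ?_
  rw [← Finset.sum_sub_distrib, Finset.mul_sum]
  refine Finset.sum_congr rfl fun j _ => ?_
  linear_combination v i * w j * hP i j

theorem DividesWedge.comp_doubleCover {a b d k : ℕ} (hd : 1 ≤ d) {h : ℂ → ℂ} {f : C3 → ℂ}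
    (hfa : AnalyticAt ℂ f 0) (hf : DividesWedge (cuspForm a b d k h) f) :
    DividesWedge (cuspForm a b (2 * d) (2 * k) fun w => h (w ^ 2)) (f ∘ doubleCover) := by
  obtain ⟨c, hc, hcf⟩ := hf.exists_coordinate_cofactors
  intro v w
  have hκt : Tendsto doubleCover (𝓝 0) (𝓝 0) := by
    have := analyticAt_doubleCover.continuousAt.tendsto
    rwa [doubleCover_zero] at this
  have hκ' : ∀ (x : C3) (i : Fin 3), AnalyticAt ℂ (fun P => fderiv ℂ doubleCover P x i) 0 := by
    intro x i
    have h1 : AnalyticAt ℂ (fun P => fderiv ℂ doubleCover P x) 0 :=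
      ((ContinuousLinearMap.apply ℂ C3 x).analyticAt _).comp analyticAt_doubleCover.fderiv
    exact (analyticAt_pi_iff.1 h1) i
  refine ⟨fun P => ∑ i, ∑ j, fderiv ℂ doubleCover P v i * fderiv ℂ doubleCover P w j *
    c i j (doubleCover P), ?_, ?_⟩
  · refine Finset.analyticAt_fun_sum _ fun i _ => Finset.analyticAt_fun_sum _ fun j _ => ?_
    exact ((hκ' v i).mul (hκ' w j)).mul
      (AnalyticAt.fun_comp (by rw [doubleCover_zero]; exact hc i j) analyticAt_doubleCover)
  · filter_upwards [hκt.eventually hcf, hκt.eventually hfa.eventually_analyticAt] with P e1 a1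
    have hd' : ∀ x, fderiv ℂ (f ∘ doubleCover) P x =
        fderiv ℂ f (doubleCover P) (fderiv ℂ doubleCover P x) := by
      intro x
      rw [fderiv_comp P a1.differentiableAt (hasFDerivAt_doubleCover P).differentiableAt]
      rfl
    rw [hd', hd', cuspForm_doubleCover _ _ _ _ hd, cuspForm_doubleCover _ _ _ _ hd, e1]
    rfl

/-- The case of a cuspidal separatrix: `d` is odd, and the two roots of its equation are exchanged
by the deck transformation `w ↦ -w` of the double cover `u = w ^ 2`. -/
theorem conclusion_of_odd {a b m k : ℕ} {h : ℂ → ℂ} (hab : 1 ≤ a + b) (hk : m + 1 ≤ k)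
    (hh : AnalyticAt ℂ h 0) :
    (∃ g : ℂ × ℂ → ℂ, AnalyticAt ℂ g 0 ∧
      FoliationEquiv (cuspForm a b (2 * m + 1) k h) (normalForm a b (2 * m + 1) g)) ∧
    (∃ V : Set C3, IsSeparatrix (cuspForm a b (2 * m + 1) k h) V ∧
      SetGermEquiv V {P | surf a b (2 * m + 1) P = 0}) := by
  set d := 2 * m + 1 with hd
  have hI := Complex.I_ne_zero
  have hdc : (d : ℂ) = 2 * m + 1 := by rw [hd]; push_cast; ring
  set H : ℂ → ℂ := fun w => h (w ^ 2) with hH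
  have hHa : AnalyticAt ℂ H 0 := AnalyticAt.fun_comp (by simpa using hh) (analyticAt_id.pow 2)
  obtain ⟨t, ht, ht0, hs⟩ := exists_solution (d := 2 * d) (k := 2 * k) (e := d) (h := H)
    (t₀ := Complex.I) (l := 2 * Complex.I) (by omega) le_rfl (by omega) hHa
    (by rw [zero_pow (by omega)]; ring)
    (by rw [Nat.sub_self, pow_zero]; push_cast; linear_combination (2 * d : ℂ) * Complex.I_mul_I)
    (by simp) (by
      intro n hn
      have h1 : 2 * (d : ℂ) * Complex.I + 2 * Complex.I * (d + n) =
        ((4 * d + 2 * n : ℕ) : ℂ) * Complex.I := by push_cast; ring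
      rw [h1]
      exact mul_ne_zero (by exact_mod_cast (by omega : 4 * d + 2 * n ≠ 0)) hI)
  obtain ⟨A, B, hA, hB, hAB⟩ := exists_even_odd ht
  have hA0 : A 0 = Complex.I := by
    have := hAB.self_of_nhds.1
    simpa [ht0] using this.symm
  -- The second solution is `z(-w)`, where `z(w) = w ^ d * t(w)` is the first one.
  have hneg : Tendsto (fun w : ℂ => -w) (𝓝 0) (𝓝 0) := by
    simpa using (continuous_neg (G := ℂ)).tendsto 0
  have htn : AnalyticAt ℂ (fun w => -t (-w)) 0 :=
    (AnalyticAt.fun_comp (by simpa using ht) analyticAt_id.neg).neg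
  have hs' : IsSolution (2 * d) (2 * k) H fun w => w ^ d * -t (-w) := by
    filter_upwards [hneg.eventually hs, hneg.eventually ht.eventually_analyticAt] with w e1 a1
    have h1 : (fun w : ℂ => w ^ d * -t (-w)) = fun w => (fun w => w ^ d * t w) (-w) := by
      funext w
      simp only [neg_pow w d, Odd.neg_one_pow (⟨m, hd⟩ : Odd d)]
      ring
    rw [h1, deriv_comp_neg (fun w : ℂ => w ^ d * t w)]
    have h2 : (-w) ^ d = -w ^ d := Odd.neg_pow ⟨m, hd⟩ w
    have h3 : (-w) ^ (2 * k) = w ^ (2 * k) := Even.neg_pow ⟨k, by ring⟩ w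
    have h4 : (-w) ^ (2 * d - 1) = -w ^ (2 * d - 1) := Odd.neg_pow ⟨2 * m, by omega⟩ w
    simp only [hH, h2, h3, h4, neg_sq] at e1 ⊢
    linear_combination -e1
  -- As `z(w) = w ^ d A(u) + u * (u ^ m B(u))` and `w ^ d = u ^ (d / 2)`, the splitting has
  -- `i α = A` and `β₁ = u ^ m B`.
  set α : ℂ → ℂ := fun u => -Complex.I * A u with hα
  set β₁ : ℂ → ℂ := fun u => u ^ m * B u with hβ₁
  have hαa : AnalyticAt ℂ α 0 := analyticAt_const.mul hA
  have hβ₁a : AnalyticAt ℂ β₁ 0 := (analyticAt_id.pow m).mul hB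
  have hsq : Tendsto (fun w : ℂ => w ^ 2) (𝓝 0) (𝓝 0) := by
    have : Continuous (fun w : ℂ => w ^ 2) := by fun_prop
    exact this.tendsto' 0 0 (by simp)
  have hwd : ∀ w : ℂ, w ^ d = w * (w ^ 2) ^ m := fun w => by
    rw [hd, pow_succ', pow_mul]
  have hwk : ∀ u : ℂ, u ^ k = u * u ^ (k - 1) := fun u => by rw [← pow_succ']; congr 1; omega
  have hdβ : ∀ᶠ u in 𝓝 (0 : ℂ), deriv (fun u => u * β₁ u) u =
      (m + 1) * u ^ m * B u + u * u ^ m * deriv B u := by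
    filter_upwards [hB.eventually_analyticAt] with u a1
    have h1 : (fun u : ℂ => u * β₁ u) = fun u => u ^ (m + 1) * B u := by
      funext u; simp only [hβ₁, pow_succ]; ring
    rw [h1, (hasDerivAt_pow_mul a1).deriv, Nat.add_sub_cancel, pow_succ]
    push_cast
    ring
  have hdα : ∀ u, deriv α u = -Complex.I * deriv A u := fun u => by
    simp only [hα, deriv_const_mul_field]
  -- Both equations in terms of the even and odd parts of `t`.
  have hsol : ∀ᶠ w in 𝓝 (0 : ℂ), ∀ s : ℂ, (s = 1 ∨ s = -1) →
      (2 * (w * (w ^ 2) ^ m * (s * A (w ^ 2) + w * B (w ^ 2))) +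
        w ^ 2 * (w ^ 2) ^ (k - 1) * h (w ^ 2)) *
        (d * (w ^ 2) ^ m * (s * A (w ^ 2) + w * B (w ^ 2)) + w * (w ^ 2) ^ m *
          (s * (2 * w * deriv A (w ^ 2)) + (B (w ^ 2) + 2 * w ^ 2 * deriv B (w ^ 2)))) +
        2 * d * w * (w ^ 2) ^ m * (w ^ 2) ^ m = 0 := by
    have hcomp : ∀ {F : ℂ → ℂ} {w : ℂ}, AnalyticAt ℂ F (w ^ 2) →
        HasDerivAt (fun w : ℂ => F (w ^ 2)) (deriv F (w ^ 2) * (2 * w)) w := by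
      intro F w hF
      have h1 := hF.differentiableAt.hasDerivAt.comp w (hasDerivAt_pow 2 w)
      refine HasDerivAt.congr_deriv h1 ?_
      simp
    have hpow : ∀ w : ℂ, w ^ (2 * d - 1) = w * (w ^ 2) ^ m * (w ^ 2) ^ m := fun w => by
      rw [mul_assoc, ← pow_mul, ← pow_add, ← pow_succ']; congr 1; omega
    have hone : ∀ (s : ℂ) (T : ℂ → ℂ), AnalyticAt ℂ T 0 →
        (∀ᶠ w in 𝓝 (0 : ℂ), T w = s * A (w ^ 2) + w * B (w ^ 2)) →
        IsSolution (2 * d) (2 * k) H (fun w => w ^ d * T w) → ∀ᶠ w in 𝓝 (0 : ℂ),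
      (2 * (w * (w ^ 2) ^ m * (s * A (w ^ 2) + w * B (w ^ 2))) +
        w ^ 2 * (w ^ 2) ^ (k - 1) * h (w ^ 2)) *
        (d * (w ^ 2) ^ m * (s * A (w ^ 2) + w * B (w ^ 2)) + w * (w ^ 2) ^ m *
          (s * (2 * w * deriv A (w ^ 2)) + (B (w ^ 2) + 2 * w ^ 2 * deriv B (w ^ 2)))) +
        2 * d * w * (w ^ 2) ^ m * (w ^ 2) ^ m = 0 := by
      intro s T hT hTe hTs
      filter_upwards [hTe, hTe.eventually_nhds, hTs, hT.eventually_analyticAt,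
        hsq.eventually hA.eventually_analyticAt, hsq.eventually hB.eventually_analyticAt]
        with w e1 e2 e3 a1 a2 a3
      rw [(hasDerivAt_pow_mul a1).deriv, EventuallyEq.deriv_eq e2,
        (((hcomp a2).const_mul s).fun_add ((hasDerivAt_id' w).fun_mul (hcomp a3))).deriv, e1,
        hpow, hwd, pow_mul w 2 k, hwk, show d - 1 = 2 * m by omega, pow_mul w 2 m] at e3
      push_cast at e3
      simp only [hH] at e3
      linear_combination e3
    filter_upwards [hone 1 t ht (hAB.mono fun w hw => by rw [hw.1, one_mul]) hs,
      hone (-1) (fun w => -t (-w)) htn (hAB.mono fun w hw => by rw [hw.2]; ring) hs']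
      with w e1 e2 s hs
    rcases hs with rfl | rfl
    · exact e1
    · exact e2
  have hsplit : IsSplitting d k d h α β₁ := by
    refine ⟨hαa, hβ₁a, by simp [hα, hA0], ?_, ?_⟩
    · have hΦ : AnalyticAt ℂ (fun u =>
          deriv (fun u => u * β₁ u) u * (2 * (u * β₁ u) + u ^ k * h u) +
          d * u ^ (d - 1) - (d * u ^ (d - 1) * α u ^ 2 + 2 * u ^ d * α u * deriv α u)) 0 :=
        (((analyticAt_deriv_mul hβ₁a).mul ((analyticAt_const.mul (analyticAt_id.mul hβ₁a)).add
          ((analyticAt_id.pow k).mul hh))).add (analyticAt_const.mul (analyticAt_id.pow _))).sub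
          (((analyticAt_const.mul (analyticAt_id.pow _)).mul (hαa.pow 2)).add
            (((analyticAt_const.mul (analyticAt_id.pow d)).mul hαa).mul hαa.deriv))
      refine (eventually_zero_of_pow_mul (M := 2) (n := 1) (by norm_num) hΦ ?_).mono
        fun u hu => sub_eq_zero.1 hu
      filter_upwards [hsol, hsq.eventually hdβ] with w e1 e2
      have e3 := e1 1 (Or.inl rfl)
      have e4 := e1 (-1) (Or.inr rfl)
      rw [e2, hdα, show d - 1 = m + m by omega, pow_add,
        show (w ^ 2) ^ d = w ^ 2 * (w ^ 2) ^ m * (w ^ 2) ^ m by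
        rw [hd, pow_succ', two_mul, pow_add, mul_assoc], hwk]
      simp only [hα, hβ₁]
      rw [hdc] at e3 e4 ⊢
      linear_combination (e3 + e4) / 4 -
        w * ((2 * m + 1) * (w ^ 2) ^ m * (w ^ 2) ^ m * A (w ^ 2) ^ 2 +
          2 * w ^ 2 * (w ^ 2) ^ m * (w ^ 2) ^ m * A (w ^ 2) * deriv A (w ^ 2)) * Complex.I_mul_I
    · refine eventually_zero_of_pow_mul (M := 2) (n := d + 1) (by norm_num)
        (analyticAt_oddPart hh hαa hβ₁a) ?_
      filter_upwards [hsol, hsq.eventually hdβ] with w e1 e2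
      have e3 := e1 1 (Or.inl rfl)
      have e4 := e1 (-1) (Or.inr rfl)
      rw [e2, hdα, pow_succ, hwd]
      simp only [hα, hβ₁]
      rw [hdc] at e3 e4 ⊢
      linear_combination -Complex.I * (e3 - e4) / 4
  refine hsplit.conclusion hab (by omega) (by omega) hh ?_
  intro f hf
  have hG : AnalyticAt ℂ (fun w => w ^ (2 * k - d) * H w) 0 := (analyticAt_id.pow _).mul hHa
  have hres : ∀ m' n : ℕ, 1 ≤ m' → 1 ≤ n → m' * (2 * t 0 + 0 ^ (2 * k - d) * H 0) ≠
      n * (2 * -t (-0) + 0 ^ (2 * k - d) * H 0) := by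
    intro m' n hm' hn heq
    rw [zero_pow (by omega), neg_zero, ht0] at heq
    have h1 : ((m' + n : ℕ) : ℂ) * (2 * Complex.I) = 0 := by
      push_cast; linear_combination heq
    rcases mul_eq_zero.1 h1 with h2 | h2
    · have : m' + n = 0 := by exact_mod_cast h2
      omega
    · simp at h2
  have hfκ : AnalyticAt ℂ (f ∘ doubleCover) 0 :=
    AnalyticAt.comp (by rw [doubleCover_zero]; exact hf.1) analyticAt_doubleCover
  have hfκ0 : ¬ ∀ᶠ P in 𝓝 (0 : C3), (f ∘ doubleCover) P = 0 := fun hc =>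
    hf.2.2.1 (eventually_of_doubleCover hc)
  refine eventually_of_doubleCover ?_
  filter_upwards [zero_mem_graphs hab (by omega) hHa hG (Eventually.of_forall fun w => by
    rw [← mul_assoc, ← pow_add]; congr 2; omega) ht htn hs hs' hres hfκ hfκ0
      (DividesWedge.comp_doubleCover (by omega) hf.1 hf.2.2.2), (tendsto_mon hab).eventually hAB]
    with P hP e1 h0
  have h1 := hP h0
  rw [e1.1, e1.2, hwd] at h1
  rw [sepEquation, mon_doubleCover, show doubleCover P 2 = P 2 from rfl]
  simp only [hα, hβ₁]
  rw [show (mon a b P ^ 2) ^ d = mon a b P ^ 2 * (mon a b P ^ 2) ^ m * (mon a b P ^ 2) ^ m by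
        rw [hd, pow_succ', two_mul, pow_add, mul_assoc]]
  linear_combination h1 + mon a b P ^ 2 * (mon a b P ^ 2) ^ m * (mon a b P ^ 2) ^ m *
    A (mon a b P ^ 2) ^ 2 * Complex.I_mul_I

/-! ### The separatrix of the saddle-node -/

/-- The restriction `σ(s, s)` of a convergent separatrix `z = u ^ k * σ(x, y)` to the diagonal
satisfies the equation of an invariant graph, in the variable `s` with `u = s ^ (a + b)`. -/
theorem saddleNode_diagonal {a b d k : ℕ} {h : ℂ → ℂ} {σ : ℂ × ℂ → ℂ} (hab : 1 ≤ a + b)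
    (hk : 1 ≤ k) (hkd : 2 * k < d) (hh : AnalyticAt ℂ h 0) (hσ : AnalyticAt ℂ σ 0)
    (hinv : DividesWedge (cuspForm a b d k h) fun P => P 2 - mon a b P ^ k * σ (P 0, P 1)) :
    ∀ᶠ s in 𝓝 (0 : ℂ), (2 * σ (s, s) + h (s ^ (a + b))) *
      (s * deriv (fun s => σ (s, s)) s + ((a + b) * k : ℕ) * σ (s, s)) +
      d * (a + b : ℕ) * s ^ ((a + b) * (d - 2 * k)) = 0 := by
  set M := a + b with hM
  set S : ℂ → ℂ := fun s => σ (s, s) with hS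
  have hdiag : AnalyticAt ℂ (fun s : ℂ => (s, s)) 0 := analyticAt_id.prod analyticAt_id
  have hSa : AnalyticAt ℂ S 0 := AnalyticAt.fun_comp (by exact hσ) hdiag
  set f : C3 → ℂ := fun P => P 2 - mon a b P ^ k * σ (P 0, P 1) with hf
  have hσP : AnalyticAt ℂ (fun P : C3 => σ (P 0, P 1)) 0 :=
    AnalyticAt.fun_comp (by exact hσ) ((analyticAt_coord 0 0).prod (analyticAt_coord 1 0))
  have hfa : AnalyticAt ℂ f 0 :=
    (analyticAt_coord 2 0).sub (((analyticAt_mon a b 0).pow k).mul hσP)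
  set γ : ℂ → C3 := fun s => ![s * 1, s * 1, s ^ (M * k) * S s] with hγ
  have hmonγ : ∀ s, mon a b (γ s) = s ^ M := fun s => by simp [mon, hγ, hM, pow_add]
  have hMk : 1 ≤ M * k := Nat.mul_pos hab hk
  have hfγ : ∀ s, f (γ s) = 0 := fun s => by
    simp only [hf, hmonγ]
    simp [hγ, hS, pow_mul]
  have hγ' : ∀ᶠ s in 𝓝 (0 : ℂ), HasDerivAt γ
      ![1, 1, (M * k : ℕ) * s ^ (M * k - 1) * S s + s ^ (M * k) * deriv S s] s :=
    hSa.eventually_analyticAt.mono fun s a1 => hasDerivAt_curve (hasDerivAt_pow_mul a1)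
  have hγt : Tendsto γ (𝓝 0) (𝓝 0) := by
    have h1 : γ 0 = 0 := by
      ext i; fin_cases i <;> simp [hγ, show M ≠ 0 by omega, show k ≠ 0 by omega]
    have := hγ'.self_of_nhds.continuousAt.tendsto
    rwa [h1] at this
  obtain ⟨c, -, hcf⟩ := hinv.exists_coordinate_cofactors
  have hmul : ∀ᶠ s in 𝓝 (0 : ℂ), s ^ (2 * (M * k)) * ((2 * S s + h (s ^ M)) *
      (s * deriv S s + (M * k : ℕ) * S s) + d * (M : ℕ) * s ^ (M * (d - 2 * k))) = 0 := by
    filter_upwards [hγt.eventually hcf, hγt.eventually hfa.eventually_analyticAt, hγ']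
      with s e1 a1 e2
    have hdf : fderiv ℂ f (γ s)
        ![1, 1, (M * k : ℕ) * s ^ (M * k - 1) * S s + s ^ (M * k) * deriv S s] = 0 := by
      have h1 := a1.differentiableAt.hasFDerivAt.comp_hasDerivAt s e2
      have h2 : f ∘ γ = fun _ => 0 := funext hfγ
      rw [h2] at h1
      exact h1.unique (hasDerivAt_const s 0)
    have hdf2 : fderiv ℂ f (γ s) (Pi.single 2 1) = 1 := by
      have h1 : HasDerivAt (fun r : ℂ => γ s + r • (Pi.single 2 1 : C3)) (Pi.single 2 1) 0 := by
        simpa using ((hasDerivAt_id (0 : ℂ)).smul_const (Pi.single 2 1 : C3)).const_add (γ s)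
      have h2 := a1.differentiableAt.hasFDerivAt.comp_hasDerivAt_of_eq (0 : ℂ) h1 (by simp)
      have h3 : (f ∘ fun r : ℂ => γ s + r • (Pi.single 2 1 : C3)) = fun r => f (γ s) + r := by
        funext r
        simp only [Function.comp, hf, mon_add_single]
        simp
        ring
      rw [h3] at h2
      exact h2.unique ((hasDerivAt_id' (0 : ℂ)).const_add _)
    have hdm : fderiv ℂ (mon a b) (γ s)
        ![1, 1, (M * k : ℕ) * s ^ (M * k - 1) * S s + s ^ (M * k) * deriv S s] =
        M * s ^ (M - 1) := by
      have h1 := (hasFDerivAt_mon a b (γ s)).comp_hasDerivAt s e2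
      have h2 : mon a b ∘ γ = fun s => s ^ M := funext hmonγ
      rw [h2] at h1
      exact h1.unique (hasDerivAt_pow M s)
    have e3 := e1 (Pi.single 2 1)
      ![1, 1, (M * k : ℕ) * s ^ (M * k - 1) * S s + s ^ (M * k) * deriv S s]
    rw [hdf, hdf2, hfγ, cuspForm_apply, cuspForm_apply, hdm, hmonγ] at e3
    have h2 : γ s 2 = s ^ (M * k) * S s := rfl
    have h3 : ∀ A B C : ℂ, (![A, B, C] : C3) 2 = C := fun _ _ _ => rfl
    rw [h2, h3, ← pow_mul, ← pow_mul] at e3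
    have h4 : s ^ (M * k) = s * s ^ (M * k - 1) := by rw [← pow_succ']; congr 1; omega
    have h5 : s * (s ^ (M * (d - 1)) * s ^ (M - 1)) =
        s ^ (2 * (M * k)) * s ^ (M * (d - 2 * k)) := by
      rw [← pow_add, ← pow_succ', ← pow_add]
      congr 1
      obtain ⟨n, rfl⟩ : ∃ n, d = 2 * k + n + 1 := ⟨d - 2 * k - 1, by omega⟩
      rw [show 2 * k + n + 1 - 1 = 2 * k + n by omega,
        show 2 * k + n + 1 - 2 * k = n + 1 by omega,
        add_assoc, Nat.sub_add_cancel hab]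
      ring
    have h6 : s ^ (2 * (M * k)) = s ^ (M * k) * s ^ (M * k) := by rw [two_mul, pow_add]
    rw [mul_add, mul_left_comm (s ^ (2 * (M * k))) (d * (M : ℂ)), ← h5, h6]
    rw [h4] at e3 ⊢
    linear_combination -s * e3
  have hSM : AnalyticAt ℂ (fun s : ℂ => h (s ^ M)) 0 :=
    AnalyticAt.fun_comp (by simpa [show M ≠ 0 by omega] using hh) (analyticAt_id.pow M)
  refine eventually_zero_of_pow_mul (M := 1) (n := 2 * (M * k)) le_rfl ?_
    (hmul.mono fun s hs => by rw [pow_one]; exact hs)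
  exact (((analyticAt_const.mul hSa).add hSM).mul ((analyticAt_id.mul hSa.deriv).add
    (analyticAt_const.mul hSa))).add (analyticAt_const.mul (analyticAt_id.pow _))

/-- A convergent separatrix through the saddle-node is a function of `u` alone, by uniqueness of
the solution of its equation. -/
theorem HasConvergentSaddleNodeSeparatrix.exists_solution {a b d k : ℕ} {h : ℂ → ℂ}
    (hab : 1 ≤ a + b) (hk : 1 ≤ k) (hkd : 2 * k < d) (hh : AnalyticAt ℂ h 0) (hh0 : h 0 ≠ 0)
    (hS : HasConvergentSaddleNodeSeparatrix a b d k h) :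
    ∃ τ : ℂ → ℂ, AnalyticAt ℂ τ 0 ∧ τ 0 = -h 0 / 2 ∧ IsSolution d k h fun u => u ^ k * τ u := by
  obtain ⟨σ, hσ, hσ0, hinv⟩ := hS
  have hred := saddleNode_diagonal hab hk hkd hh hσ hinv.2.2.2
  set M := a + b with hM
  have hM0 : (M : ℂ) ≠ 0 := by exact_mod_cast (by omega : M ≠ 0)
  have hk0 : (k : ℂ) ≠ 0 := by exact_mod_cast (by omega : k ≠ 0)
  set S : ℂ → ℂ := fun s => σ (s, s) with hS
  have hSa : AnalyticAt ℂ S 0 :=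
    AnalyticAt.fun_comp (by exact hσ) (analyticAt_id.prod analyticAt_id)
  have hS0 : S 0 = -h 0 / 2 := hσ0
  have hSM : AnalyticAt ℂ (fun s : ℂ => h (s ^ M)) 0 :=
    AnalyticAt.fun_comp (by simpa [show M ≠ 0 by omega] using hh) (analyticAt_id.pow M)
  obtain ⟨τ, hτ, hτS⟩ := exists_comp_pow hSa hab (fun ζ hζ => by
    have hζt : Tendsto (fun s : ℂ => ζ * s) (𝓝 0) (𝓝 0) :=
      (continuous_const_mul ζ).tendsto' 0 0 (by simp)
    have hζa : AnalyticAt ℂ (fun s => S (ζ * s)) 0 :=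
      AnalyticAt.fun_comp (by simpa using hSa) (analyticAt_const.mul analyticAt_id)
    refine analytic_solution_unique (e := M * k) (G := fun s => h (s ^ M))
      (E := fun s => d * (M : ℕ) * s ^ (M * (d - 2 * k))) hSM hζa hSa (by simp) ?_ ?_ hred
    · intro n _
      have h1 : 2 * S (ζ * 0) + h (0 ^ M) = 0 := by
        rw [mul_zero, hS0, zero_pow (by omega)]; ring
      rw [h1, zero_mul, add_zero, mul_zero, hS0]
      push_cast
      exact mul_ne_zero (mul_ne_zero two_ne_zero (mul_ne_zero hM0 hk0))
        (div_ne_zero (neg_ne_zero.2 hh0) two_ne_zero)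
    · filter_upwards [hζt.eventually hred, hζt.eventually hSa.eventually_analyticAt] with s e1 a1
      have h1 : deriv (fun s => S (ζ * s)) s = ζ * deriv S (ζ * s) := by
        have h2 := a1.differentiableAt.hasDerivAt.comp s ((hasDerivAt_id' s).const_mul ζ)
        exact h2.deriv.trans (by ring)
      have h3 : σ (ζ * s, ζ * s) = S (ζ * s) := rfl
      rw [h1]
      rw [h3, pow_mul (ζ * s), mul_pow, hζ, one_mul, ← pow_mul] at e1
      linear_combination e1)
  have hpow : Tendsto (fun w : ℂ => w ^ M) (𝓝 0) (𝓝 0) :=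
    (continuous_pow M).tendsto' 0 0 (by simp [show M ≠ 0 by omega])
  refine ⟨τ, hτ, ?_, isSolution_of_reduced hk hkd.le le_rfl hτ
    (eventually_of_eventually_pow hab ?_)⟩
  · have := hτS.self_of_nhds
    rw [zero_pow (by omega)] at this
    rw [← this, hS0]
  · filter_upwards [hred, hτS, hτS.eventually_nhds, hpow.eventually hτ.eventually_analyticAt]
      with s e1 e2 e3 a1
    have h1 : s * deriv S s = M * (s ^ M * deriv τ (s ^ M)) := by
      have h2 := a1.differentiableAt.hasDerivAt.comp s (hasDerivAt_pow M s)
      have h3 : deriv S s = deriv τ (s ^ M) * (M * s ^ (M - 1)) :=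
        (EventuallyEq.deriv_eq e3).trans h2.deriv
      have h4 : s ^ M = s * s ^ (M - 1) := by rw [← pow_succ']; congr 1; omega
      rw [h3]
      nth_rewrite 2 [h4]
      ring
    have h5 : σ (s, s) = τ (s ^ M) := e2
    rw [h1, h5] at e1
    rw [Nat.sub_self, pow_zero, one_mul, ← pow_mul]
    refine mul_left_cancel₀ hM0 ?_
    push_cast at e1
    linear_combination e1

/-! ### The remaining cases -/

/-- The case of two invariant graphs with leading coefficients `t₁, t₂` such that `t₁ t₂ = 1`. -/
theorem conclusion_of_two_mul_eq {a b k : ℕ} {h : ℂ → ℂ} (hab : 1 ≤ a + b) (hk : 1 ≤ k)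
    (hh : AnalyticAt ℂ h 0)
    (hP : ∀ s : ℚ, 0 ≤ s → h 0 ^ 2 ≠ (16 + (s : ℂ)) ^ 2 / (16 + 2 * (s : ℂ))) :
    (∃ g : ℂ × ℂ → ℂ, AnalyticAt ℂ g 0 ∧
      FoliationEquiv (cuspForm a b (2 * k) k h) (normalForm a b (2 * k) g)) ∧
    (∃ V : Set C3, IsSeparatrix (cuspForm a b (2 * k) k h) V ∧
      SetGermEquiv V {P | surf a b (2 * k) P = 0}) := by
  -- The leading coefficients are the roots of `t ^ 2 + h(0) t / 2 + 1`, of discriminant `δ ^ 2`.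
  obtain ⟨δ, hδ⟩ := IsAlgClosed.exists_pow_nat_eq (h 0 ^ 2 / 4 - 4) (n := 2) (by norm_num)
  have key : ∀ t₁ t₂ : ℂ, t₁ * t₂ = 1 → t₁ + t₂ = -h 0 / 2 → ∃ t : ℂ → ℂ, AnalyticAt ℂ t 0 ∧
      t 0 = t₁ ∧ IsSolution (2 * k) k h fun u => u ^ k * t u := by
    intro t₁ t₂ hprod hsum
    refine exists_solution (l := -2 * t₂) hk le_rfl le_rfl hh
      (by rw [Nat.sub_self, pow_zero]; linear_combination 2 * hsum)
      (by rw [Nat.sub_self, pow_zero]; push_cast; linear_combination (-2 * k : ℂ) * hprod)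
      (by rintro hc; rw [mul_eq_zero] at hc; simp at hc; simp [hc] at hprod) ?_
    intro n hn hc
    refine not_resonant hP hprod hsum (m := k + n) (n := k) (by omega) hk ?_
    push_cast
    linear_combination -hc / 2
  have hprod : (-h 0 / 2 + δ) / 2 * ((-h 0 / 2 - δ) / 2) = 1 := by linear_combination -hδ / 4
  have hsum : (-h 0 / 2 + δ) / 2 + (-h 0 / 2 - δ) / 2 = -h 0 / 2 := by ring
  obtain ⟨t₁, ht₁, h₁, hs₁⟩ := key _ _ hprod hsum
  obtain ⟨t₂, ht₂, h₂, hs₂⟩ := key _ _ (by rw [mul_comm, hprod]) (by rw [add_comm, hsum])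
  refine conclusion_of_solutions hab hk hk le_rfl hh ht₁ ht₂ hs₁ hs₂ fun m n hm hn hc => ?_
  rw [Nat.sub_self, pow_zero, h₁, h₂] at hc
  refine not_resonant hP hprod hsum hm hn ?_
  linear_combination -hc / 2

/-- The case of a saddle-node: one graph has leading coefficient `0`, the other one is the
separatrix of the saddle-node, with leading coefficient `- h(0) / 2`. -/
theorem conclusion_of_two_mul_lt {a b d k : ℕ} {h : ℂ → ℂ} (hab : 1 ≤ a + b) (hk : 1 ≤ k)
    (hkd : 2 * k < d) (hh : AnalyticAt ℂ h 0) (hh0 : h 0 ≠ 0)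
    (hS : HasConvergentSaddleNodeSeparatrix a b d k h) :
    (∃ g : ℂ × ℂ → ℂ, AnalyticAt ℂ g 0 ∧
      FoliationEquiv (cuspForm a b d k h) (normalForm a b (2 * k) g)) ∧
    (∃ V : Set C3, IsSeparatrix (cuspForm a b d k h) V ∧
      SetGermEquiv V {P | surf a b (2 * k) P = 0}) := by
  obtain ⟨t₁, ht₁, h₁, hs₁⟩ := exists_solution (d := d) (h := h) (t₀ := 0) (l := h 0) hk hkd.le
    le_rfl hh (by simp) (by rw [zero_pow (by omega)]; simp) hh0 (by
      intro n hn
      rw [mul_zero, zero_add]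
      exact mul_ne_zero hh0 (by exact_mod_cast (by omega : k + n ≠ 0)))
  obtain ⟨t₂, ht₂, h₂, hs₂⟩ := hS.exists_solution hab hk hkd hh hh0
  refine conclusion_of_solutions hab hk hk le_rfl hh ht₁ ht₂ hs₁ hs₂ fun m n hm hn hc => ?_
  rw [Nat.sub_self, pow_zero, h₁, h₂] at hc
  have h3 : (m : ℂ) * h 0 = 0 := by linear_combination hc
  exact mul_ne_zero (by exact_mod_cast (by omega : m ≠ 0)) hh0 h3

/-- The case of even `d`, with two invariant graphs of leading coefficients `± i`. -/
theorem conclusion_of_even {a b e k : ℕ} {h : ℂ → ℂ} (hab : 1 ≤ a + b) (he : 1 ≤ e) (hek : e < k)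
    (hh : AnalyticAt ℂ h 0) :
    (∃ g : ℂ × ℂ → ℂ, AnalyticAt ℂ g 0 ∧
      FoliationEquiv (cuspForm a b (2 * e) k h) (normalForm a b (2 * e) g)) ∧
    (∃ V : Set C3, IsSeparatrix (cuspForm a b (2 * e) k h) V ∧
      SetGermEquiv V {P | surf a b (2 * e) P = 0}) := by
  have key : ∀ t₀ : ℂ, t₀ ^ 2 = -1 → ∃ t : ℂ → ℂ, AnalyticAt ℂ t 0 ∧
      t 0 = t₀ ∧ IsSolution (2 * e) k h fun u => u ^ e * t u := by
    intro t₀ ht₀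
    have h0 : t₀ ≠ 0 := by rintro rfl; norm_num at ht₀
    refine exists_solution (l := 2 * t₀) he le_rfl hek.le hh
      (by rw [zero_pow (by omega)]; ring)
      (by rw [Nat.sub_self, pow_zero]; push_cast; linear_combination (2 * e : ℂ) * ht₀)
      (mul_ne_zero two_ne_zero h0) fun n hn => ?_
    have h1 : 2 * (e : ℂ) * t₀ + 2 * t₀ * (e + n) = ((4 * e + 2 * n : ℕ) : ℂ) * t₀ := by
      push_cast; ring
    rw [h1]
    exact mul_ne_zero (by exact_mod_cast (by omega : 4 * e + 2 * n ≠ 0)) h0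
  obtain ⟨t₁, ht₁, h₁, hs₁⟩ := key Complex.I Complex.I_sq
  obtain ⟨t₂, ht₂, h₂, hs₂⟩ := key (-Complex.I) (by rw [neg_sq, Complex.I_sq])
  refine conclusion_of_solutions hab (by omega) he hek.le hh ht₁ ht₂ hs₁ hs₂ fun m n hm hn hc => ?_
  rw [zero_pow (by omega), h₁, h₂] at hc
  have h3 : ((m + n : ℕ) : ℂ) * Complex.I = 0 := by push_cast; linear_combination hc / 2
  exact mul_ne_zero (by exact_mod_cast (by omega : m + n ≠ 0)) Complex.I_ne_zero h3

end CuspidalFoliation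

theorem mainTheorem2 (p' q' d k : ℕ) (h : ℂ → ℂ) (hpq : Nat.Coprime p' q')
    (hd : 1 ≤ d) (hk : 1 ≤ k) (hh : AnalyticAt ℂ h 0) (hh0 : h 0 ≠ 0)
    (hP : 2 * k = d → ∀ s : ℚ, 0 ≤ s → h 0 ^ 2 ≠ (16 + (s : ℂ)) ^ 2 / (16 + 2 * (s : ℂ)))
    (hS : 2 * k < d → CuspidalFoliation.HasConvergentSaddleNodeSeparatrix p' q' d k h)
    (r : ℕ) (hr : r = if d ≤ 2 * k then d else 2 * k) :
    (∃ g : ℂ × ℂ → ℂ, AnalyticAt ℂ g 0 ∧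
      CuspidalFoliation.FoliationEquiv (CuspidalFoliation.cuspForm p' q' d k h)
        (CuspidalFoliation.normalForm p' q' r g)) ∧
    (∃ V : Set CuspidalFoliation.C3,
      CuspidalFoliation.IsSeparatrix (CuspidalFoliation.cuspForm p' q' d k h) V ∧
      CuspidalFoliation.SetGermEquiv V {P | CuspidalFoliation.surf p' q' r P = 0}) := by
  have hab : 1 ≤ p' + q' := by
    by_contra hc
    obtain ⟨rfl, rfl⟩ : p' = 0 ∧ q' = 0 := by omega
    simp at hpq
  subst hr
  rcases lt_trichotomy (2 * k) d with hlt | heq | hgt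
  · rw [if_neg (by omega)]
    exact CuspidalFoliation.conclusion_of_two_mul_lt hab hk hlt hh hh0 (hS hlt)
  · subst heq
    rw [if_pos le_rfl]
    exact CuspidalFoliation.conclusion_of_two_mul_eq hab hk hh (hP rfl)
  · rw [if_pos hgt.le]
    obtain ⟨e, rfl | rfl⟩ := Nat.even_or_odd' d
    · exact CuspidalFoliation.conclusion_of_even hab (by omega) (by omega) hh
    · exact CuspidalFoliation.conclusion_of_odd hab (by omega) hh
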